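/- Let $\Omega\subset\mathbb R^2$ be a bounded open set with boundary $\Gamma$, and let $\Omega_+,\Omega_-\subset\Omega$ be disjoint open sets with $\bar\Omega=\bar\Omega_+\cup\bar\Omega_-$. Let $a\in L^\infty(\Omega)$ be real valued, and suppose that for some $\epsilon_0>0$ one has $a\ge\epsilon_0$ a.e. in $\Omega_+$ and $a\le-\epsilon_0$ a.e. in $\Omega_-$. Let $f\in L^2(\Omega)$, let $B(v,w)=\int_\Omega a\,\nabla v\cdot\nabla w$, and let $u\in H^1_0(\Omega)$ satisfy $B(u,v)=\int_\Omega f v$ for all $v\in H^1_0(\Omega)$. Let $\mathcal T$ be a finite conforming triangulation of $\Omega$: finitely many closed nondegenerate triangles that cover $\bar\Omega$, have their interiors in $\Omega$, and of which any two different ones are disjoint or meet exactly in a common vertex or a common edge. Suppose that every $T\in\mathcal T$ is contained in $\bar\Omega_+$ or in $\bar\Omega_-$, that $h_T/\rho_T\le\sigma$ for every $T\in\mathcal T$, where $h_T$ is the diameter of $T$ and $\rho_T$ the diameter of its largest inscribed ball, and that $a$ is constant on every $T\in\mathcal T$. For a fixed integer $\ell\ge1$ let $V_h$ be the space of all $v\in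 H^1_0(\Omega)$ whose restriction to each $T\in\mathcal T$ is a polynomial of degree at most $\ell$, and let $u_h\in V_h$ satisfy $B(u_h,v_h)=\int_\Omega f v_h$ for all $v_h\in V_h$. For each $T\in\mathcal T$ let $f_T$ be a polynomial of degree at most a fixed integer $m\ge0$ (for instance, with $m=0$, the mean value $f_T=|T|^{-1}\int_T f$). Write $\|\cdot\|_D$ for the $L^2(D)$-norm, $|v|_{1,D}=\|\nabla v\|_D$, and $\omega_T=\bigcup\{T'\in\mathcal T: T'\cap T\neq\emptyset\}$. Put $$\eta_{R,T}=h_T\,\|f_T+\operatorname{div}(a\nabla u_h)\|_T,\qquad \eta_{J,T}=\sum_{e}h_e^{1/2}\,\big\|[\![a\nabla u_h\cdot n_e]\!]\big\|_e ,$$ $$\operatorname{osc}(f,\omega_T)^2=\sum_{T'\in\mathcal T,\ T'\subset\omega_T}h_{T'}^2\,\|f-f_{T'}\|_{T'}^2 ,$$ where $e$ runs through the interior edges of $T$ (those that lie in $\Omega$, except possibly for their endpoints), $h_e$ is the length of $e$, $n_e$ a unit normal vector of $e$, and $[\![\cdot]\!]$ the jump across $e$. Then for every $T\in\mathcal T$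 $$\eta_{R,T}+\eta_{J,T}\le C\,\big(|u-u_h|_{1,\omega_T}+\operatorname{osc}(f,\omega_T)\big),$$ where the constant $C>0$ depends only on $\ell$, on $m$, on the aspect ratio bound $\sigma$ and on an upper bound $M$ for $\|a\|_{L^\infty(\Omega)}$. -/

import Mathlib

open MeasureTheory Filter Topology
open scoped ContDiff

namespace SignFEM

noncomputable section

/-- The Euclidean plane. -/
abbrev Plane := EuclideanSpace ℝ (Fin 2)

/-- A nondegenerate triangle, given by its three (affinely independent) vertices. -/
abbrev Triangle := Affine.Simplex ℝ Plane 2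

/-! ### Sobolev spaces -/

/-- Smooth functions with compact support in `Ω`. -/
def IsTestFunction (Ω : Set Plane) (φ : Plane → ℝ) : Prop :=
  ContDiff ℝ ∞ φ ∧ HasCompactSupport φ ∧ tsupport φ ⊆ Ω

/-- `u ∈ H¹(Ω)`, with weak gradient `g`. -/
structure IsH1 (Ω : Set Plane) (u : Plane → ℝ) (g : Plane → Plane) : Prop where
  memLp : MemLp u 2 (volume.restrict Ω)
  memLp_grad : MemLp g 2 (volume.restrict Ω)
  weak_grad : ∀ φ : Plane → ℝ, IsTestFunction Ω φ →
    ∫ x in Ω, u x • gradient φ x = - ∫ x in Ω, φ x • g x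

/-- `u ∈ H¹₀(Ω)`, with weak gradient `g`: `u` lies in the closure of the test functions
in `H¹(Ω)`. -/
structure IsH10 (Ω : Set Plane) (u : Plane → ℝ) (g : Plane → Plane) : Prop
    extends IsH1 Ω u g where
  approx : ∃ φ : ℕ → Plane → ℝ, (∀ n, IsTestFunction Ω (φ n)) ∧
    Tendsto (fun n => eLpNorm (fun x => u x - φ n x) 2 (volume.restrict Ω)) atTop (𝓝 0) ∧
    Tendsto (fun n => eLpNorm (fun x => g x - gradient (φ n) x) 2 (volume.restrict Ω))
      atTop (𝓝 0)

/-- The bilinear form `B(u, v) = ∫_Ω a ∇u · ∇v`, as a function of the two gradients. -/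
def bilinB (Ω : Set Plane) (a : Plane → ℝ) (gu gv : Plane → Plane) : ℝ :=
  ∫ x in Ω, a x * inner ℝ (gu x) (gv x)

/-- `u` (with gradient `gu`) is a weak solution in `H¹₀(Ω)` of `-div (a ∇u) = f`:
`B(u, v) = ∫_Ω f v` for all `v ∈ H¹₀(Ω)`. -/
def IsWeakSolution (Ω : Set Plane) (a f : Plane → ℝ) (u : Plane → ℝ) (gu : Plane → Plane) :
    Prop :=
  IsH10 Ω u gu ∧ ∀ (v : Plane → ℝ) (gv : Plane → Plane), IsH10 Ω v gv →
    bilinB Ω a gu gv = ∫ x in Ω, f x * v x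

/-- The `L²(D)`-norm of a square integrable function. -/
def l2norm {F : Type*} [NormedAddCommGroup F] (D : Set Plane) (w : Plane → F) : ℝ :=
  Real.sqrt (∫ x in D, ‖w x‖ ^ 2)

/-! ### Triangles and triangulations -/

/-- The closed triangle with the vertices of `T`. -/
def cell (T : Triangle) : Set Plane := convexHull ℝ (Set.range T.points)

/-- The diameter `h_T`. -/
def hT (T : Triangle) : ℝ := Metric.diam (cell T)

/-- The diameter `ρ_T` of the largest ball contained in `T`. -/
def rhoT (T : Triangle) : ℝ := sSup {d : ℝ | ∃ c : Plane, Metric.ball c (d / 2) ⊆ cell T}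

/-- A conforming triangulation of `Ω`: finitely many closed triangles that cover `closure Ω`,
whose interiors lie in `Ω`, and any two of which meet exactly in the convex hull of their
common vertices (nothing, a common vertex, or a common edge, if they are different). -/
structure Triangulation (Ω : Set Plane) where
  cells : Finset Triangle
  cover : (⋃ T ∈ cells, cell T) = closure Ω
  interior_subset : ∀ T ∈ cells, interior (cell T) ⊆ Ω
  conforming : ∀ T ∈ cells, ∀ T' ∈ cells,
    cell T ∩ cell T' = convexHull ℝ (Set.range T.points ∩ Set.range T'.points)
  /-- no triangle is listed twice, with its vertices in a different order -/
  eq_of_range_eq : ∀ T ∈ cells, ∀ T' ∈ cells,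
    Set.range T.points = Set.range T'.points → T = T'

/-- Regularity with aspect ratio `σ`: `h_T / ρ_T ≤ σ` for all triangles. -/
def Triangulation.IsRegular {Ω : Set Plane} (𝒯 : Triangulation Ω) (σ : ℝ) : Prop :=
  ∀ T ∈ 𝒯.cells, hT T ≤ σ * rhoT T

/-- The patch `ω_T`, the union of all triangles that meet `T`. -/
def Triangulation.patch {Ω : Set Plane} (𝒯 : Triangulation Ω) (T : Triangle) : Set Plane :=
  ⋃ T' ∈ 𝒯.cells, ⋃ _ : (cell T' ∩ cell T).Nonempty, cell T'

/-! ### Piecewise polynomials and the discrete problem -/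

/-- The value of a polynomial in two variables at a point. -/
def evalAt (p : MvPolynomial (Fin 2) ℝ) (x : Plane) : ℝ := MvPolynomial.eval (fun i => x i) p

/-- The gradient of a polynomial at a point. -/
def gradAt (p : MvPolynomial (Fin 2) ℝ) (x : Plane) : Plane :=
  !₂[evalAt (MvPolynomial.pderiv 0 p) x, evalAt (MvPolynomial.pderiv 1 p) x]

/-- The Laplacian of a polynomial at a point. -/
def laplAt (p : MvPolynomial (Fin 2) ℝ) (x : Plane) : ℝ :=
  evalAt (MvPolynomial.pderiv 0 (MvPolynomial.pderiv 0 p)) x +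
    evalAt (MvPolynomial.pderiv 1 (MvPolynomial.pderiv 1 p)) x

/-- `v` coincides on every triangle `T` with the polynomial `p T`, of degree at most `ℓ`. -/
def Triangulation.IsPiecewisePoly {Ω : Set Plane} (𝒯 : Triangulation Ω) (ℓ : ℕ)
    (v : Plane → ℝ) (p : Triangle → MvPolynomial (Fin 2) ℝ) : Prop :=
  ∀ T ∈ 𝒯.cells, (p T).totalDegree ≤ ℓ ∧ ∀ᵐ x ∂volume.restrict (cell T), v x = evalAt (p T) x

/-- `v` (with gradient `gv`) belongs to the finite element space
`V_h = {v ∈ H¹₀(Ω) : v|_T ∈ ℙ_ℓ(T) for all T}`. -/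
def Triangulation.IsFE {Ω : Set Plane} (𝒯 : Triangulation Ω) (ℓ : ℕ)
    (v : Plane → ℝ) (gv : Plane → Plane) : Prop :=
  IsH10 Ω v gv ∧ ∃ p : Triangle → MvPolynomial (Fin 2) ℝ, 𝒯.IsPiecewisePoly ℓ v p

/-- `uh ∈ V_h` is a Galerkin approximation: `B(uh, v) = ∫_Ω f v` for all `v ∈ V_h`. -/
def Triangulation.IsGalerkin {Ω : Set Plane} (𝒯 : Triangulation Ω) (ℓ : ℕ) (a f : Plane → ℝ)
    (uh : Plane → ℝ) (guh : Plane → Plane) : Prop :=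
  𝒯.IsFE ℓ uh guh ∧ ∀ (v : Plane → ℝ) (gv : Plane → Plane), 𝒯.IsFE ℓ v gv →
    bilinB Ω a guh gv = ∫ x in Ω, f x * v x

/-! ### Estimators

`aT T` is the constant value of `a` on `T`, `fT T` is the polynomial that approximates `f` on `T`
(for instance the constant polynomial `MvPolynomial.C (⨍ x in cell T, f x)`, the mean value), and `p T` is the polynomial with which the discrete solution coincides on `T`. -/

/-- `η_{R,T} = h_T ‖f_T + div (a ∇u_h)‖_T`. -/
def etaR (aT : Triangle → ℝ) (fT p : Triangle → MvPolynomial (Fin 2) ℝ) (T : Triangle) : ℝ :=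
  hT T * l2norm (cell T) (fun x => evalAt (fT T) x + aT T * laplAt (p T) x)

/-- The endpoints of the edge of `T` opposite to the vertex `i`. -/
def edgeFst (T : Triangle) (i : Fin 3) : Plane := T.points (i + 1)

/-- See `edgeFst`. -/
def edgeSnd (T : Triangle) (i : Fin 3) : Plane := T.points (i + 2)

/-- A unit normal vector of the segment from `P` to `Q`. -/
def unitNormal (P Q : Plane) : Plane := ‖Q - P‖⁻¹ • !₂[Q 1 - P 1, P 0 - Q 0]

/-- The norm of `L²(e)` with respect to arc length, for the segment `e` from `P` to `Q`. -/
def l2edge (P Q : Plane) (w : Plane → ℝ) : ℝ :=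
  Real.sqrt (dist P Q * ∫ t in (0 : ℝ)..1, w (AffineMap.lineMap P Q t) ^ 2)

/-- `T'` is another triangle having the edge of `T` opposite to the vertex `i` as an edge. -/
def IsNeighbour (T : Triangle) (i : Fin 3) (T' : Triangle) : Prop :=
  T' ≠ T ∧ edgeFst T i ∈ Set.range T'.points ∧ edgeSnd T i ∈ Set.range T'.points

/-- The edge opposite to the vertex `i` is an interior edge: without its endpoints it lies
in `Ω`. -/
def IsInteriorEdge (Ω : Set Plane) (T : Triangle) (i : Fin 3) : Prop :=
  openSegment ℝ (edgeFst T i) (edgeSnd T i) ⊆ Ω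

open Classical in
/-- `η_{J,T} = ∑_e h_e^{1/2} ‖[a ∇u_h · n_e]‖_e`, over the interior edges `e` of `T`. The inner sum
has exactly one term, for the triangle `T'` on the other side of `e`; the sign of the jump and of
the normal vector do not matter. -/
def Triangulation.etaJ {Ω : Set Plane} (𝒯 : Triangulation Ω) (aT : Triangle → ℝ)
    (p : Triangle → MvPolynomial (Fin 2) ℝ) (T : Triangle) : ℝ :=
  ∑ i : Fin 3 with IsInteriorEdge Ω T i, ∑ T' ∈ 𝒯.cells with IsNeighbour T i T',
    Real.sqrt (dist (edgeFst T i) (edgeSnd T i)) *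
      l2edge (edgeFst T i) (edgeSnd T i) (fun x =>
        inner ℝ (aT T • gradAt (p T) x - aT T' • gradAt (p T') x)
          (unitNormal (edgeFst T i) (edgeSnd T i)))

open Classical in
/-- `osc(f, ω_T) = (∑_{T' ⊆ ω_T} h_{T'}² ‖f - f_{T'}‖²_{T'})^{1/2}`. -/
def Triangulation.osc {Ω : Set Plane} (𝒯 : Triangulation Ω) (f : Plane → ℝ)
    (fT : Triangle → MvPolynomial (Fin 2) ℝ) (T : Triangle) : ℝ :=
  Real.sqrt (∑ T' ∈ 𝒯.cells with cell T' ⊆ 𝒯.patch T,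
    hT T' ^ 2 * l2norm (cell T') (fun x => f x - evalAt (fT T') x) ^ 2)

end

end SignFEM

open SignFEM

namespace SignFEM

/-! ### Norm equivalence on finite-dimensional spaces of functions -/

/-! The bound is local, and it comes from testing the weak equation for `u` with functions
concentrated on one triangle or around one edge. Coercivity plays no part: `a` enters only through
its constant value on each cell and through `|a| ≤ M`, so its sign is irrelevant. For a smooth test
function `v`, each cell satisfies the identity ∫ a∇u·∇v − ∫ fv + ∫ rv − α∫ (∇p·∇v + Δp v) = α∫
∇(u−u_h)·∇v − ∫ (f−f_T)v, where `p` is the polynomial of u_h, `α` the value of `a` and r = f_T +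
αΔp. The right side is controlled by the error and the oscillation
(`IsResidualSetting.abs_residual_le`). On the left, the weak equation removes the first two terms
and Green's formula turns the last into a boundary term.

For the element residual (`exists_element_residual_le`), v is r times a smooth cut-off on a ball
inside the cell, with radius comparable to h_T. The boundary term vanishes, and ∫ rv dominates the
integral of r² over a smaller ball. For the jump (`exists_jump_le`), v is a cut-off around the
midpoint of the edge times the jump polynomial, extended constantly in the normal direction. Near
the midpoint the two adjacent triangles are complementary half-planes (`IsSide`), so only Green's
formula on a half-plane is needed; the two boundary terms add up to the integral of jump times v.
The element residuals that remain are already bounded.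

Cut-offs can replace the usual polynomial bubbles because all norms on polynomials of bounded degree
are equivalent: the L²-norm on a small ball or interval controls values and derivatives on the unit
ball or on [-1, 1] (`exists_evalAt_sq_le`, `exists_eval_sq_le`). Rescaling by the diameter or the
edge length yields constants that depend only on the degrees, σ and M. Shape regularity supplies the
balls: barycentric coordinates have slope at most 1/ρ_T (`rhoT_mul_abs_linear_le`). -/

/-- Pointwise bounded families of linear functionals on a finite-dimensional space are uniformly
bounded with respect to a positive definite bilinear form. -/
theorem exists_forall_sq_le_of_posDef {V ι : Type*} [AddCommGroup V] [Module ℝ V]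
    [FiniteDimensional ℝ V] (B : V →ₗ[ℝ] V →ₗ[ℝ] ℝ) (hsymm : ∀ v w, B v w = B w v)
    (hnonneg : ∀ v, 0 ≤ B v v) (hdef : ∀ v, B v v = 0 → v = 0) (L : ι → V →ₗ[ℝ] ℝ)
    (hL : ∀ v, ∃ K, ∀ i, |L i v| ≤ K) :
    ∃ C, 0 < C ∧ ∀ v i, L i v ^ 2 ≤ C * B v v := by
  -- With `B` as the inner product, an orthonormal basis turns the claim into Cauchy–Schwarz for
  -- coordinates, and pointwise boundedness is needed only at the finitely many basis vectors.
  let core : InnerProductSpace.Core ℝ V :=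
    { inner := fun v w => B v w
      conj_inner_symm := fun v w => by simpa using hsymm w v
      re_inner_nonneg := fun v => by simpa using hnonneg v
      add_left := fun v w z => by simp
      smul_left := fun v w r => by simp
      definite := hdef }
  let _ : NormedAddCommGroup V := core.toNormedAddCommGroup
  let _ : InnerProductSpace ℝ V := InnerProductSpace.ofCore core.toCore
  have hB : ∀ v w, inner ℝ v w = B v w := fun v w => rfl
  let e := stdOrthonormalBasis ℝ V
  choose K hK using hL
  refine ⟨∑ j, K (e j) ^ 2 + 1, by positivity, fun v i => ?_⟩
  have h1 : L i v = ∑ j, inner ℝ (e j) v * L i (e j) := by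
    conv_lhs => rw [← e.sum_repr' v]
    simp
  have h2 : ∑ j, inner ℝ (e j) v ^ 2 = B v v := by
    rw [← hB, real_inner_self_eq_norm_sq, ← e.sum_sq_norm_inner_right v]
    simp
  rw [h1]
  refine (Finset.sum_mul_sq_le_sq_mul_sq _ _ _).trans ?_
  rw [h2, mul_comm]
  refine mul_le_mul_of_nonneg_right ?_ (hnonneg v)
  have : ∑ j, L i (e j) ^ 2 ≤ ∑ j, K (e j) ^ 2 :=
    Finset.sum_le_sum fun j _ => sq_le_sq.2 ((hK _ i).trans (le_abs_self _))
  linarith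

/-- On a finite-dimensional space of continuous functions, pointwise bounded families of linear
functionals are uniformly bounded by the `L²`-norm on a compact set on which no nonzero element of
the space vanishes. -/
theorem exists_forall_sq_le_setIntegral {V ι X : Type*} [AddCommGroup V] [Module ℝ V]
    [FiniteDimensional ℝ V] [TopologicalSpace X] [T2Space X] [MeasurableSpace X]
    [OpensMeasurableSpace X]
    (μ : Measure X) [IsFiniteMeasureOnCompacts μ] [μ.IsOpenPosMeasure]
    (ev : V →ₗ[ℝ] X → ℝ) (hcont : ∀ v, Continuous (ev v)) {S U : Set X} (hS : IsCompact S)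
    (hU : IsOpen U) (hUS : U ⊆ S) (hinj : ∀ v, (∀ x ∈ U, ev v x = 0) → v = 0)
    (L : ι → V →ₗ[ℝ] ℝ) (hL : ∀ v, ∃ K, ∀ i, |L i v| ≤ K) :
    ∃ C, 0 < C ∧ ∀ v i, L i v ^ 2 ≤ C * ∫ x in S, ev v x ^ 2 ∂μ := by
  have hint : ∀ v w, Integrable (fun x => ev v x * ev w x) (μ.restrict S) := fun v w =>
    ((hcont v).mul (hcont w)).continuousOn.integrableOn_compact hS
  let B : V →ₗ[ℝ] V →ₗ[ℝ] ℝ := LinearMap.mk₂ ℝ (fun v w => ∫ x in S, ev v x * ev w x ∂μ)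
    (fun v w z => by
      rw [← integral_add (hint _ _) (hint _ _)]; simp [add_mul])
    (fun c v w => by
      rw [smul_eq_mul, ← integral_const_mul]; simp [mul_assoc])
    (fun v w z => by
      rw [← integral_add (hint _ _) (hint _ _)]; simp [mul_add])
    (fun c v w => by
      rw [smul_eq_mul, ← integral_const_mul]; simp [mul_left_comm])
  have hB : ∀ v, B v v = ∫ x in S, ev v x ^ 2 ∂μ := fun v => by
    simp [B, sq]
  obtain ⟨C, hC, h⟩ := exists_forall_sq_le_of_posDef B
    (fun v w => by simp [B, mul_comm])
    (fun v => by rw [hB]; positivity)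
    -- A zero integral gives vanishing almost everywhere; continuity upgrades this to vanishing
    -- everywhere on the open set `U`.
    (fun v hv => by
      rw [hB, setIntegral_eq_zero_iff_of_nonneg_ae
        (Eventually.of_forall fun x => sq_nonneg _) (by simp only [sq]; exact hint v v)] at hv
      refine hinj v fun x hx => ?_
      have h0 : ev v =ᵐ[μ.restrict U] 0 := by
        filter_upwards [ae_restrict_of_ae_restrict_of_subset hUS hv] with y hy
        simpa using hy
      exact Measure.eqOn_open_of_ae_eq h0 hU (hcont v).continuousOn continuousOn_const hx)
    L hL
  exact ⟨C, hC, fun v i => by rw [← hB]; exact h v i⟩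

/-! ### Polynomials in two variables as functions on the plane -/

theorem contDiff_evalAt (p : MvPolynomial (Fin 2) ℝ) : ContDiff ℝ ∞ (evalAt p) := by
  unfold evalAt
  induction p using MvPolynomial.induction_on with
  | C a => simpa using contDiff_const
  | add p q hp hq => simpa using hp.add hq
  | mul_X p i hp => simp only [map_mul, MvPolynomial.eval_X]; fun_prop

theorem continuous_evalAt (p : MvPolynomial (Fin 2) ℝ) : Continuous (evalAt p) :=
  (contDiff_evalAt p).continuous

theorem continuous_gradAt (p : MvPolynomial (Fin 2) ℝ) : Continuous (gradAt p) := by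
  unfold gradAt
  refine (PiLp.continuous_toLp 2 _).comp (continuous_pi fun i => ?_)
  fin_cases i <;> exact continuous_evalAt _

theorem continuous_laplAt (p : MvPolynomial (Fin 2) ℝ) : Continuous (laplAt p) :=
  (continuous_evalAt _).add (continuous_evalAt _)

theorem inner_plane (x y : Plane) : inner ℝ x y = x 0 * y 0 + x 1 * y 1 := by
  simp [PiLp.inner_apply, Fin.sum_univ_two, mul_comm]

theorem norm_sq_plane (x : Plane) : ‖x‖ ^ 2 = x 0 ^ 2 + x 1 ^ 2 := by
  rw [← real_inner_self_eq_norm_sq, inner_plane]; ring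

theorem hasFDerivAt_evalAt (p : MvPolynomial (Fin 2) ℝ) (x : Plane) :
    HasFDerivAt (evalAt p) (innerSL ℝ (gradAt p x)) x := by
  induction p using MvPolynomial.induction_on with
  | C a =>
    have h1 : evalAt (MvPolynomial.C a) = fun _ => a := by ext; simp [evalAt]
    have h2 : innerSL ℝ (gradAt (MvPolynomial.C a) x) = 0 := by
      ext y; simp [gradAt, inner_plane, evalAt]
    rw [h1, h2]; exact hasFDerivAt_const _ _
  | add p q hp hq =>
    have h1 : evalAt (p + q) = evalAt p + evalAt q := by ext; simp [evalAt]
    have h2 : gradAt (p + q) x = gradAt p x + gradAt q x := by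
      ext i; fin_cases i <;> simp [gradAt, evalAt]
    rw [h1, h2, map_add]; exact hp.add hq
  | mul_X p i hp =>
    have h1 : evalAt (p * MvPolynomial.X i) = fun y => evalAt p y * y i := by ext; simp [evalAt]
    have h3 : HasFDerivAt (fun y : Plane => y i) (EuclideanSpace.proj i : Plane →L[ℝ] ℝ) x :=
      (EuclideanSpace.proj i : Plane →L[ℝ] ℝ).hasFDerivAt
    rw [h1]
    convert! hp.mul h3 using 1
    ext y
    fin_cases i <;>
      simp [gradAt, evalAt, inner_plane, MvPolynomial.pderiv_X] <;> ring

theorem gradient_evalAt (p : MvPolynomial (Fin 2) ℝ) (x : Plane) :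
    gradient (evalAt p) x = gradAt p x :=
  (show HasGradientAt (evalAt p) (gradAt p x) x from hasFDerivAt_evalAt p x).gradient

/-! ### Degrees under differentiation and substitution -/

theorem totalDegree_pderiv_le {ι : Type*} (i : ι) (p : MvPolynomial ι ℝ) :
    (MvPolynomial.pderiv i p).totalDegree ≤ p.totalDegree := by
  classical
  conv_lhs => rw [p.as_sum, map_sum]
  refine MvPolynomial.totalDegree_finsetSum_le fun s hs => ?_
  rw [MvPolynomial.pderiv_monomial]
  refine (MvPolynomial.totalDegree_monomial_le _ _).trans (le_trans ?_
    (MvPolynomial.le_totalDegree hs))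
  exact Finsupp.sum_le_sum_index (tsub_le_self : s - Finsupp.single i 1 ≤ s)
    (fun i _ => monotone_id) (fun i _ => rfl)

theorem totalDegree_aeval_le {ι : Type*} {q : ι → MvPolynomial ι ℝ}
    (hq : ∀ i, (q i).totalDegree ≤ 1) (p : MvPolynomial ι ℝ) :
    (MvPolynomial.aeval q p).totalDegree ≤ p.totalDegree := by
  rw [MvPolynomial.aeval_def, MvPolynomial.eval₂_eq]
  refine MvPolynomial.totalDegree_finsetSum_le fun s hs => ?_
  refine le_trans ?_ (MvPolynomial.le_totalDegree hs)
  refine (MvPolynomial.totalDegree_mul _ _).trans ?_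
  have h0 : (algebraMap ℝ (MvPolynomial ι ℝ) (p.coeff s)).totalDegree = 0 :=
    MvPolynomial.totalDegree_C _
  rw [h0, zero_add]
  refine (MvPolynomial.totalDegree_finsetProd _ _).trans (Finset.sum_le_sum fun i _ => ?_)
  refine (MvPolynomial.totalDegree_pow _ _).trans ?_
  simpa using Nat.mul_le_mul_left (s i) (hq i)

theorem natDegree_aeval_le {ι : Type*} {q : ι → Polynomial ℝ}
    (hq : ∀ i, (q i).natDegree ≤ 1) (p : MvPolynomial ι ℝ) :
    (MvPolynomial.aeval q p).natDegree ≤ p.totalDegree := by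
  rw [MvPolynomial.aeval_def, MvPolynomial.eval₂_eq]
  refine Polynomial.natDegree_sum_le_of_forall_le _ _ fun s hs => ?_
  refine le_trans ?_ (MvPolynomial.le_totalDegree hs)
  refine (Polynomial.natDegree_C_mul_le _ _).trans ?_
  refine (Polynomial.natDegree_prod_le _ _).trans (Finset.sum_le_sum fun i _ => ?_)
  refine Polynomial.natDegree_pow_le.trans ?_
  simpa using Nat.mul_le_mul_left (s i) (hq i)

/-- The composition of a polynomial with a dilation and a translation. -/
theorem exists_evalAt_comp (p : MvPolynomial (Fin 2) ℝ) (c : Plane) (h : ℝ) :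
    ∃ q : MvPolynomial (Fin 2) ℝ, q.totalDegree ≤ p.totalDegree ∧
      ∀ y : Plane, evalAt q y = evalAt p (c + h • y) := by
  refine ⟨MvPolynomial.aeval
    (fun i => MvPolynomial.C (c i) + MvPolynomial.C h * MvPolynomial.X i) p,
    totalDegree_aeval_le (fun i => ?_) p, fun y => ?_⟩
  · refine (MvPolynomial.totalDegree_add _ _).trans (max_le (by simp) ?_)
    refine (MvPolynomial.totalDegree_mul _ _).trans ?_
    simp
  · unfold evalAt
    induction p using MvPolynomial.induction_on with
    | C a => simp
    | add p q hp hq => rw [map_add, map_add, hp, hq, map_add]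
    | mul_X p i hp => rw [map_mul, map_mul, hp]; simp

/-- The restriction of a polynomial to a line. -/
theorem exists_eval_line (p : MvPolynomial (Fin 2) ℝ) (c d : Plane) :
    ∃ q : Polynomial ℝ, q.natDegree ≤ p.totalDegree ∧
      ∀ s : ℝ, q.eval s = evalAt p (c + s • d) := by
  refine ⟨MvPolynomial.aeval
    (fun i => Polynomial.C (c i) + Polynomial.C (d i) * Polynomial.X) p,
    natDegree_aeval_le (fun i => ?_) p, fun y => ?_⟩
  · compute_degree
  · unfold evalAt
    induction p using MvPolynomial.induction_on with
    | C a => simp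
    | add p q hp hq => simp [hp, hq]
    | mul_X p i hp => simp [hp]; left; ring

/-! ### Uniform bounds for polynomials -/

/-- The ball contains the open square (0, r/2)², and a real polynomial that vanishes on a product of
infinite sets is zero. -/
theorem eq_zero_of_evalAt_eq_zero {r : ℝ} (hr : 0 < r) (p : MvPolynomial (Fin 2) ℝ)
    (h : ∀ x ∈ Metric.ball (0 : Plane) r, evalAt p x = 0) : p = 0 := by
  refine MvPolynomial.funext_set (fun _ : Fin 2 => Set.Ioo (0 : ℝ) (r / 2))
    (fun _ => Set.Ioo_infinite (by positivity)) fun x hx => ?_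
  simp only [Set.mem_pi, Set.mem_univ, true_imp_iff, Set.mem_Ioo] at hx
  have := h (WithLp.toLp 2 x) ?_
  · simpa [evalAt] using this
  · rw [mem_ball_zero_iff, ← sq_lt_sq₀ (norm_nonneg _) hr.le, norm_sq_plane]
    have h0 := hx 0
    have h1 := hx 1
    simp only
    nlinarith

/-- Bounds for the values and the gradient of a polynomial on the unit ball by its `L²`-norm on a
small ball. -/
theorem exists_evalAt_sq_le (k : ℕ) {r : ℝ} (hr : 0 < r) :
    ∃ C, 0 < C ∧ ∀ q : MvPolynomial (Fin 2) ℝ, q.totalDegree ≤ k → ∀ y : Plane, ‖y‖ ≤ 1 →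
      evalAt q y ^ 2 ≤ C * ∫ x in Metric.closedBall (0 : Plane) r, evalAt q x ^ 2 ∧
      ‖gradAt q y‖ ^ 2 ≤ C * ∫ x in Metric.closedBall (0 : Plane) r, evalAt q x ^ 2 := by
  let V := MvPolynomial.restrictTotalDegree (Fin 2) ℝ k
  -- The functionals are q ↦ (D q)(y) with y in the unit ball; compactness bounds them for each
  -- fixed q. Taking the identity and the two partial derivatives for `D` covers values and
  -- gradient.
  have main : ∀ D : MvPolynomial (Fin 2) ℝ →ₗ[ℝ] MvPolynomial (Fin 2) ℝ,
      ∃ C, 0 < C ∧ ∀ q : MvPolynomial (Fin 2) ℝ, q.totalDegree ≤ k → ∀ y : Plane, ‖y‖ ≤ 1 →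
      evalAt (D q) y ^ 2 ≤ C * ∫ x in Metric.closedBall (0 : Plane) r, evalAt q x ^ 2 := by
    intro D
    obtain ⟨C, hC, h⟩ := exists_forall_sq_le_setIntegral (V := V)
      (ι := Metric.closedBall (0 : Plane) 1) (volume : Measure Plane)
      { toFun := fun q => evalAt q.1
        map_add' := fun p q => by ext; simp [evalAt]
        map_smul' := fun p q => by ext; simp [evalAt] }
      (fun q => continuous_evalAt q.1)
      (isCompact_closedBall (0 : Plane) r) Metric.isOpen_ball Metric.ball_subset_closedBall
      (fun q hq => Subtype.ext (eq_zero_of_evalAt_eq_zero hr q.1 hq))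
      (fun y =>
        { toFun := fun q => evalAt (D q.1) y
          map_add' := fun p q => by simp [evalAt]
          map_smul' := fun p q => by simp [evalAt] })
      (fun q => by
        obtain ⟨K, hK⟩ := (isCompact_closedBall (0 : Plane) 1).exists_bound_of_continuousOn
          (continuous_evalAt (D q.1)).continuousOn
        exact ⟨K, fun y => hK y.1 y.2⟩)
    exact ⟨C, hC, fun q hq y hy =>
      h ⟨q, (MvPolynomial.mem_restrictTotalDegree _ _ _).2 hq⟩ ⟨y, by simpa using hy⟩⟩
  obtain ⟨C, hC, h⟩ := main LinearMap.id
  obtain ⟨C₀, hC₀, h₀⟩ := main (MvPolynomial.pderiv 0).toLinearMap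
  obtain ⟨C₁, hC₁, h₁⟩ := main (MvPolynomial.pderiv 1).toLinearMap
  refine ⟨C + C₀ + C₁, by positivity, fun q hq y hy => ?_⟩
  have hI : 0 ≤ ∫ x in Metric.closedBall (0 : Plane) r, evalAt q x ^ 2 := by positivity
  have e := h q hq y hy
  have e₀ := h₀ q hq y hy
  have e₁ := h₁ q hq y hy
  simp only [LinearMap.id_apply, Derivation.coeFn_coe] at e e₀ e₁
  constructor
  · nlinarith
  · rw [norm_sq_plane]
    simp only [gradAt, PiLp.toLp_apply, Matrix.cons_val_zero, Matrix.cons_val_one]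
    nlinarith

/-- Bounds for the values and the derivative of a polynomial on `[-1, 1]` by its `L²`-norm on a
small interval. -/
theorem exists_eval_sq_le (k : ℕ) {r : ℝ} (hr : 0 < r) :
    ∃ C, 0 < C ∧ ∀ q : Polynomial ℝ, q.natDegree ≤ k → ∀ y : ℝ, |y| ≤ 1 →
      q.eval y ^ 2 ≤ C * ∫ x in Set.Icc (-r) r, q.eval x ^ 2 ∧
      q.derivative.eval y ^ 2 ≤ C * ∫ x in Set.Icc (-r) r, q.eval x ^ 2 := by
  let V := Polynomial.degreeLT ℝ (k + 1)
  have main : ∀ D : Polynomial ℝ →ₗ[ℝ] Polynomial ℝ,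
      ∃ C, 0 < C ∧ ∀ q : Polynomial ℝ, q.natDegree ≤ k → ∀ y : ℝ, |y| ≤ 1 →
      (D q).eval y ^ 2 ≤ C * ∫ x in Set.Icc (-r) r, q.eval x ^ 2 := by
    intro D
    have : FiniteDimensional ℝ V := inferInstance
    obtain ⟨C, hC, h⟩ := exists_forall_sq_le_setIntegral (V := V)
      (ι := Set.Icc (-1 : ℝ) 1) (volume : Measure ℝ)
      { toFun := fun q x => q.1.eval x
        map_add' := fun p q => by ext; simp
        map_smul' := fun p q => by ext; simp }
      (fun q => q.1.continuous)
      (isCompact_Icc (a := -r) (b := r)) isOpen_Ioo Set.Ioo_subset_Icc_self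
      (fun q hq => Subtype.ext (Polynomial.eq_zero_of_infinite_isRoot _
        ((Set.Ioo_infinite (show -r < r by linarith)).mono hq)))
      (fun y =>
        { toFun := fun q => (D q.1).eval y.1
          map_add' := fun p q => by simp
          map_smul' := fun p q => by simp })
      (fun q => by
        obtain ⟨K, hK⟩ := (isCompact_Icc (a := (-1 : ℝ)) (b := 1)).exists_bound_of_continuousOn
          (D q.1).continuous.continuousOn
        exact ⟨K, fun y => hK y.1 y.2⟩)
    exact ⟨C, hC, fun q hq y hy => h ⟨q, Polynomial.mem_degreeLT.2
      (Polynomial.degree_le_natDegree.trans_lt (by exact_mod_cast Nat.lt_succ_of_le hq))⟩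
      ⟨y, abs_le.1 hy⟩⟩
  obtain ⟨C, hC, h⟩ := main LinearMap.id
  obtain ⟨C₁, hC₁, h₁⟩ := main Polynomial.derivative
  refine ⟨C + C₁, by positivity, fun q hq y hy => ?_⟩
  have hI : 0 ≤ ∫ x in Set.Icc (-r) r, q.eval x ^ 2 := by positivity
  have e := h q hq y hy
  have e₁ := h₁ q hq y hy
  simp only [LinearMap.id_apply] at e
  constructor <;> nlinarith

/-! ### Gradients of smooth functions -/

theorem continuous_gradient {v : Plane → ℝ} (hv : ContDiff ℝ ∞ v) : Continuous (gradient v) :=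
  (LinearIsometryEquiv.continuous _).comp (hv.continuous_fderiv (by simp))

theorem tsupport_gradient_subset (v : Plane → ℝ) : tsupport (gradient v) ⊆ tsupport v := by
  refine (closure_mono fun x hx => ?_).trans (tsupport_fderiv_subset ℝ (f := v))
  simp only [Function.mem_support, gradient] at hx ⊢
  exact fun h => hx (by rw [h, map_zero])

theorem HasCompactSupport.gradient {v : Plane → ℝ} (hv : HasCompactSupport v) :
    HasCompactSupport (gradient v) :=
  hv.mono' (subset_tsupport _ |>.trans (tsupport_gradient_subset v))

theorem fderiv_apply_eq_inner_gradient (v : Plane → ℝ) (x d : Plane) :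
    fderiv ℝ v x d = inner ℝ (gradient v x) d := by
  simp [gradient]

theorem gradient_mul {v w : Plane → ℝ} (hv : ContDiff ℝ ∞ v) (hw : ContDiff ℝ ∞ w) (x : Plane) :
    gradient (fun y => v y * w y) x = v x • gradient w x + w x • gradient v x := by
  simp only [gradient]
  rw [fderiv_fun_mul (hv.differentiable (by simp) x) (hw.differentiable (by simp) x)]
  simp

/-! ### The divergence theorem on the plane and on half-planes -/

theorem integral_fderiv_apply_eq_zero {G : Plane → ℝ} (hG : ContDiff ℝ ∞ G)
    (hs : HasCompactSupport G) (d : Plane) : ∫ x, fderiv ℝ G x d = 0 := by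
  -- Integration by parts against the constant function 1.
  have h := integral_mul_fderiv_eq_neg_fderiv_mul_of_integrable (μ := (volume : Measure Plane))
    (f := fun _ => (1 : ℝ)) (g := G) (v := d) (by simp)
    (by
      have h1 : Continuous fun x => 1 * fderiv ℝ G x d := by
        have := hG.continuous_fderiv (by simp)
        fun_prop
      refine h1.integrable_of_hasCompactSupport ?_
      simpa using hs.fderiv_apply ℝ d)
    (by simpa using hG.continuous.integrable_of_hasCompactSupport hs)
    (fun x _ => by fun_prop) (fun x _ => hG.differentiable (by simp) x)
  simpa using h

theorem integral_gradient_eq_zero {G : Plane → ℝ} (hG : ContDiff ℝ ∞ G)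
    (hs : HasCompactSupport G) : ∫ x, gradient G x = 0 := by
  refine ext_inner_left ℝ fun d => ?_
  rw [← integral_inner ((continuous_gradient hG).integrable_of_hasCompactSupport
    (HasCompactSupport.gradient hs)), inner_zero_right, ← integral_fderiv_apply_eq_zero hG hs d]
  simp_rw [fderiv_apply_eq_inner_gradient, real_inner_comm]

/-- The plane in the coordinates given by a point and an orthonormal pair of vectors. -/
theorem exists_measurePreserving_coords (m τ n : Plane) (hτ : ‖τ‖ = 1) (hn : ‖n‖ = 1)
    (hτn : inner ℝ τ n = 0) :
    MeasurePreserving (fun z : ℝ × ℝ => m + (z.1 • τ + z.2 • n)) ∧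
      MeasurableEmbedding (fun z : ℝ × ℝ => m + (z.1 • τ + z.2 • n)) ∧
      ∀ d : Plane, d = inner ℝ d τ • τ + inner ℝ d n • n := by
  have hnτ : inner ℝ n τ = 0 := by rw [real_inner_comm]; exact hτn
  have hon : Orthonormal ℝ ![τ, n] := by
    rw [orthonormal_iff_ite]
    intro i j
    fin_cases i <;> fin_cases j <;> simp [hτn, hnτ, hτ, hn]
  have hsp : ⊤ ≤ Submodule.span ℝ (Set.range ![τ, n]) := by
    rw [hon.linearIndependent.span_eq_top_of_card_eq_finrank (by simp)]
  let b := OrthonormalBasis.mk hon hsp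
  have h0 : b 0 = τ := by simp [b]
  have h1 : b 1 = n := by simp [b]
  have key : (fun z : ℝ × ℝ => m + (z.1 • τ + z.2 • n)) = (fun x => m + x) ∘ b.repr.symm ∘
      (MeasurableEquiv.toLp 2 (Fin 2 → ℝ)) ∘ (MeasurableEquiv.finTwoArrow (α := ℝ)).symm := by
    funext z
    simp only [Function.comp_apply, add_right_inj]
    rw [← b.sum_repr_symm, Fin.sum_univ_two, h0, h1]
    simp [MeasurableEquiv.finTwoArrow]
  refine ⟨?_, ?_, fun d => ?_⟩
  · rw [key]
    exact (measurePreserving_add_left volume m).comp (b.measurePreserving_repr_symm.comp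
      ((EuclideanSpace.volume_preserving_symm_measurableEquiv_toLp _).symm.comp
        (volume_preserving_finTwoArrow ℝ).symm))
  · rw [key]
    exact (measurableEmbedding_addLeft m).comp
      (b.repr.symm.toHomeomorph.measurableEmbedding.comp
      ((MeasurableEquiv.measurableEmbedding _).comp (MeasurableEquiv.measurableEmbedding _)))
  · conv_lhs => rw [← b.sum_repr' d]
    rw [Fin.sum_univ_two, h0, h1, real_inner_comm, real_inner_comm d n]

theorem isClosedEmbedding_line (c : Plane) {e : Plane} (he : ‖e‖ = 1) :
    IsClosedEmbedding (fun s : ℝ => c + s • e) := by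
  refine Isometry.isClosedEmbedding (Isometry.of_dist_eq fun s t => ?_)
  rw [dist_add_left, dist_eq_norm, ← sub_smul, norm_smul, he, mul_one, Real.dist_eq,
    Real.norm_eq_abs]

/-- This makes two triangles on opposite sides of an edge disjoint up to a null set. -/
theorem volume_line_eq_zero (m τ n : Plane) (hτ : ‖τ‖ = 1) (hn : ‖n‖ = 1)
    (hτn : inner ℝ τ n = 0) : volume {x : Plane | inner ℝ (x - m) n = 0} = 0 := by
  obtain ⟨hmp, hemb, -⟩ := exists_measurePreserving_coords m τ n hτ hn hτn
  rw [← hmp.measure_preimage_emb hemb]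
  have hpre : (fun z : ℝ × ℝ => m + (z.1 • τ + z.2 • n)) ⁻¹' {x | inner ℝ (x - m) n = 0} =
      Set.univ ×ˢ {(0 : ℝ)} := by
    ext z
    simp [inner_add_left, inner_smul_left, hτn, hn]
  rw [hpre, Measure.volume_eq_prod, Measure.prod_prod]
  simp

/-- The divergence theorem on a half-plane. -/
theorem setIntegral_halfPlane_fderiv {G : Plane → ℝ} (hG : ContDiff ℝ ∞ G)
    (hs : HasCompactSupport G) (m τ n : Plane) (hτ : ‖τ‖ = 1) (hn : ‖n‖ = 1)
    (hτn : inner ℝ τ n = 0) (d : Plane) :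
    ∫ x in {x | 0 ≤ inner ℝ (x - m) n}, fderiv ℝ G x d =
      - (inner ℝ d n * ∫ s : ℝ, G (m + s • τ)) := by
  obtain ⟨hmp, hemb, hdec⟩ := exists_measurePreserving_coords m τ n hτ hn hτn
  set Φ : ℝ × ℝ → Plane := fun z => m + (z.1 • τ + z.2 • n) with hΦ
  have hpre : Φ ⁻¹' {x | 0 ≤ inner ℝ (x - m) n} = Set.univ ×ˢ Set.Ici (0 : ℝ) := by
    ext z
    simp [hΦ, inner_add_left, inner_smul_left, hτn, hn]
  have hint : ∀ e : Plane, Integrable (fun x => fderiv ℝ G x e) := fun e =>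
    ((hG.continuous_fderiv (by simp)).clm_apply
      continuous_const).integrable_of_hasCompactSupport (hs.fderiv_apply ℝ e)
  have hint' : ∀ e : Plane, Integrable (fun z : ℝ × ℝ => fderiv ℝ G (Φ z) e)
      ((volume.restrict Set.univ).prod (volume.restrict (Set.Ici 0))) := fun e => by
    rw [Measure.prod_restrict]
    exact ((hmp.integrable_comp_emb hemb).2 (hint e)).integrableOn
  have hDG : ∀ x, HasFDerivAt G (fderiv ℝ G x) x := fun x =>
    (hG.differentiable (by simp) x).hasFDerivAt
  have hdiff : Differentiable ℝ G := hG.differentiable (by simp)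
  have hcs : ∀ (c e : Plane), ‖e‖ = 1 → HasCompactSupport (fun s : ℝ => G (c + s • e)) := by
    intro c e he
    exact hs.comp_isClosedEmbedding (isClosedEmbedding_line c he)
  have hcd : ∀ c e : Plane, ContDiff ℝ 1 (fun s : ℝ => G (c + s • e)) := fun c e =>
    (hG.of_le (by simp)).comp (by fun_prop)
  have hder : ∀ (c e : Plane) (s : ℝ),
      deriv (fun s : ℝ => G (c + s • e)) s = fderiv ℝ G (c + s • e) e := by
    intro c e s
    have h1 : HasDerivAt (fun s : ℝ => c + s • e) e s := by
      simpa using ((hasDerivAt_id s).smul_const e).const_add c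
    exact ((hDG _).comp_hasDerivAt s h1).deriv
  -- Tangential part: along each line parallel to the boundary, the derivative of a compactly
  -- supported function integrates to zero.
  have hτpart : ∫ z in Set.univ ×ˢ Set.Ici (0 : ℝ), fderiv ℝ G (Φ z) τ = 0 := by
    rw [Measure.volume_eq_prod, ← Measure.prod_restrict, integral_prod_symm _ (hint' τ)]
    refine integral_eq_zero_of_ae (Eventually.of_forall fun t => ?_)
    simp only [Measure.restrict_univ, Pi.zero_apply]
    have e1 : ∀ s, Φ (s, t) = (m + t • n) + s • τ := fun s => by simp only [hΦ]; abel
    simp_rw [e1, ← hder]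
    refine integral_eq_zero_of_hasDerivAt_of_integrable (f := fun s => G (m + t • n + s • τ))
      (fun s => ((hcd _ _).differentiable (by simp) s).hasDerivAt) ?_ ?_
    · exact ((hcd _ _).continuous_deriv le_rfl).integrable_of_hasCompactSupport (hcs _ _ hτ).deriv
    · exact (hcd _ _).continuous.integrable_of_hasCompactSupport (hcs _ _ hτ)
  -- Normal part: the fundamental theorem of calculus on each half-line leaves minus the boundary
  -- value.
  have hnpart : ∫ z in Set.univ ×ˢ Set.Ici (0 : ℝ), fderiv ℝ G (Φ z) n =
      - ∫ s : ℝ, G (m + s • τ) := by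
    rw [Measure.volume_eq_prod, ← Measure.prod_restrict, integral_prod _ (hint' n),
      Measure.restrict_univ, ← integral_neg]
    refine integral_congr_ae (Eventually.of_forall fun s => ?_)
    have e1 : ∀ t, Φ (s, t) = (m + s • τ) + t • n := fun t => by simp only [hΦ]; abel
    simp_rw [e1, ← hder]
    rw [integral_Ici_eq_integral_Ioi,
      HasCompactSupport.integral_Ioi_deriv_eq (hcd _ _) (hcs _ _ hn)]
    simp
  rw [← hmp.setIntegral_preimage_emb hemb, hpre]
  have e2 : ∀ z, fderiv ℝ G (Φ z) d =
      inner ℝ d τ * fderiv ℝ G (Φ z) τ + inner ℝ d n * fderiv ℝ G (Φ z) n := by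
    intro z
    conv_lhs => rw [hdec d]
    simp
  have hint'' : ∀ e : Plane, Integrable (fun z : ℝ × ℝ => fderiv ℝ G (Φ z) e)
      (volume.restrict (Set.univ ×ˢ Set.Ici 0)) := fun e => by
    rw [Measure.volume_eq_prod, ← Measure.prod_restrict]; exact hint' e
  simp_rw [e2]
  rw [integral_add ((hint'' τ).const_mul _) ((hint'' n).const_mul _), integral_const_mul,
    integral_const_mul, hτpart, hnpart]
  ring

/-- The divergence of `v ∇p`, as a sum of directional derivatives. -/
theorem inner_gradAt_add_laplAt_mul {v : Plane → ℝ} (hv : ContDiff ℝ ∞ v)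
    (p : MvPolynomial (Fin 2) ℝ) (x : Plane) :
    inner ℝ (gradAt p x) (gradient v x) + laplAt p x * v x =
      ∑ i : Fin 2, fderiv ℝ (fun y => evalAt (MvPolynomial.pderiv i p) y * v y) x
        (EuclideanSpace.single i 1) := by
  have h : ∀ i : Fin 2, fderiv ℝ (fun y => evalAt (MvPolynomial.pderiv i p) y * v y) x
      (EuclideanSpace.single i 1) = evalAt (MvPolynomial.pderiv i p) x * gradient v x i +
        evalAt (MvPolynomial.pderiv i (MvPolynomial.pderiv i p)) x * v x := by
    intro i
    rw [fderiv_apply_eq_inner_gradient, gradient_mul (contDiff_evalAt _) hv, gradient_evalAt,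
      inner_plane]
    fin_cases i <;> simp [gradAt] <;> ring
  rw [Fin.sum_univ_two, h, h, inner_plane]
  simp only [gradAt, laplAt, PiLp.toLp_apply, Matrix.cons_val_zero, Matrix.cons_val_one]
  ring

theorem integrable_fderiv_evalAt_mul {v : Plane → ℝ} (hv : ContDiff ℝ ∞ v)
    (hs : HasCompactSupport v) (q : MvPolynomial (Fin 2) ℝ) (d : Plane) :
    Integrable (fun x => fderiv ℝ (fun y => evalAt q y * v y) x d) :=
  ((((contDiff_evalAt q).mul hv).continuous_fderiv (by simp)).clm_apply
    continuous_const).integrable_of_hasCompactSupport ((hs.mul_left).fderiv_apply ℝ d)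

/-- Green's formula on the plane. -/
theorem integral_inner_gradAt_add_laplAt_mul {v : Plane → ℝ} (hv : ContDiff ℝ ∞ v)
    (hs : HasCompactSupport v) (p : MvPolynomial (Fin 2) ℝ) :
    ∫ x, (inner ℝ (gradAt p x) (gradient v x) + laplAt p x * v x) = 0 := by
  simp_rw [inner_gradAt_add_laplAt_mul hv]
  rw [integral_finsetSum _ fun i _ => integrable_fderiv_evalAt_mul hv hs _ _]
  exact Finset.sum_eq_zero fun i _ =>
    integral_fderiv_apply_eq_zero ((contDiff_evalAt _).mul hv) hs.mul_left _

/-- Green's formula on a half-plane. -/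
theorem setIntegral_halfPlane_inner_gradAt_add_laplAt_mul {v : Plane → ℝ} (hv : ContDiff ℝ ∞ v)
    (hs : HasCompactSupport v) (p : MvPolynomial (Fin 2) ℝ) (m τ n : Plane) (hτ : ‖τ‖ = 1)
    (hn : ‖n‖ = 1) (hτn : inner ℝ τ n = 0) :
    ∫ x in {x | 0 ≤ inner ℝ (x - m) n},
        (inner ℝ (gradAt p x) (gradient v x) + laplAt p x * v x) =
      - ∫ s : ℝ, inner ℝ (gradAt p (m + s • τ)) n * v (m + s • τ) := by
  have hint : ∀ q : MvPolynomial (Fin 2) ℝ,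
      Integrable (fun s : ℝ => evalAt q (m + s • τ) * v (m + s • τ)) := by
    intro q
    have hvc := hv.continuous
    have hqc := continuous_evalAt q
    refine Continuous.integrable_of_hasCompactSupport (by fun_prop) ?_
    exact (hs.comp_isClosedEmbedding (isClosedEmbedding_line m hτ)).mul_left
  simp_rw [inner_gradAt_add_laplAt_mul hv]
  rw [integral_finsetSum _ fun i _ => (integrable_fderiv_evalAt_mul hv hs _ _).integrableOn]
  simp_rw [setIntegral_halfPlane_fderiv ((contDiff_evalAt _).mul hv) hs.mul_left m τ n hτ hn hτn]
  rw [Finset.sum_neg_distrib, Fin.sum_univ_two]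
  congr 1
  rw [← integral_const_mul, ← integral_const_mul,
    ← integral_add ((hint _).const_mul _) ((hint _).const_mul _)]
  refine integral_congr_ae (Eventually.of_forall fun s => ?_)
  simp [inner_plane, gradAt]
  ring

/-! ### Test functions and weak gradients -/

/-- This admits smooth bubbles in the weak formulation. The weak gradient identity says that the
gradient of the compactly supported product has integral zero, and the constant sequence serves as
approximation. -/
theorem IsTestFunction.isH10 {Ω : Set Plane} {φ : Plane → ℝ} (h : IsTestFunction Ω φ) :
    IsH10 Ω φ (gradient φ) where
  memLp := (h.1.continuous.memLp_of_hasCompactSupport h.2.1).restrict _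
  memLp_grad := ((continuous_gradient h.1).memLp_of_hasCompactSupport
    (HasCompactSupport.gradient h.2.1)).restrict _
  weak_grad ψ hψ := by
    rw [setIntegral_eq_integral_of_forall_compl_eq_zero fun x hx => by
        rw [image_eq_zero_of_notMem_tsupport fun h' => hx (h.2.2 h'), zero_smul],
      setIntegral_eq_integral_of_forall_compl_eq_zero fun x hx => by
        rw [image_eq_zero_of_notMem_tsupport fun h' => hx (hψ.2.2 h'), zero_smul],
      eq_neg_iff_add_eq_zero, ← integral_add,
      ← integral_gradient_eq_zero (h.1.mul hψ.1) h.2.1.mul_right]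
    · exact integral_congr_ae (Eventually.of_forall fun x => (gradient_mul h.1 hψ.1 x).symm)
    · exact (h.1.continuous.smul (continuous_gradient hψ.1)).integrable_of_hasCompactSupport
        h.2.1.smul_right
    · exact (hψ.1.continuous.smul (continuous_gradient h.1)).integrable_of_hasCompactSupport
        hψ.2.1.smul_right
  approx := ⟨fun _ => φ, fun _ => h, by simp, by simp⟩

/-- The weak gradient of a function that coincides with a polynomial on an open set. -/
theorem IsH1.ae_eq_gradAt {Ω U : Set Plane} {u : Plane → ℝ} {g : Plane → Plane}
    (h : IsH1 Ω u g) (hΩ : IsOpen Ω) (hU : IsOpen U) (hUΩ : U ⊆ Ω) (p : MvPolynomial (Fin 2) ℝ)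
    (hp : ∀ᵐ x ∂volume.restrict U, u x = evalAt p x) :
    ∀ᵐ x ∂volume.restrict U, g x = gradAt p x := by
  have hloc : LocallyIntegrableOn (fun x => g x - gradAt p x) U := by
    refine LocallyIntegrableOn.sub ?_ ((continuous_gradAt p).locallyIntegrable.locallyIntegrableOn _)
    exact (locallyIntegrableOn_of_locallyIntegrable_restrict
      (h.memLp_grad.locallyIntegrable (by norm_num))).mono_set hUΩ
  -- Fundamental lemma of the calculus of variations: against test functions supported in `U`, both
  -- fields integrate to −∫ p∇φ.
  have key := hU.ae_eq_zero_of_integral_contDiff_smul_eq_zero hloc fun φ hφ hφs hφU => by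
    have h0 : ∀ x, x ∉ U → φ x = 0 := fun x hx =>
      image_eq_zero_of_notMem_tsupport fun h' => hx (hφU h')
    have h0' : ∀ x, x ∉ U → gradient φ x = 0 := fun x hx =>
      image_eq_zero_of_notMem_tsupport fun h' => hx (hφU (tsupport_gradient_subset φ h'))
    have i1 : Integrable (fun x => φ x • g x) (volume.restrict Ω) := by
      have : MemLp φ 2 (volume.restrict Ω) :=
        (hφ.continuous.memLp_of_hasCompactSupport hφs).restrict _
      exact memLp_one_iff_integrable.1 (h.memLp_grad.smul (r := 1) this)
    have i2 : Integrable (fun x => φ x • gradAt p x) :=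
      (hφ.continuous.smul (continuous_gradAt p)).integrable_of_hasCompactSupport hφs.smul_right
    have i3 : Integrable (fun x => evalAt p x • gradient φ x) :=
      ((continuous_evalAt p).smul (continuous_gradient hφ)).integrable_of_hasCompactSupport
        (HasCompactSupport.gradient hφs).smul_left
    rw [← setIntegral_eq_integral_of_forall_compl_eq_zero (s := Ω) fun x hx => by
      rw [h0 x fun h' => hx (hUΩ h'), zero_smul]]
    simp_rw [smul_sub]
    rw [integral_sub i1 i2.integrableOn, sub_eq_zero, ← neg_inj,
      ← h.weak_grad φ ⟨hφ, hφs, hφU.trans hUΩ⟩,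
      setIntegral_eq_integral_of_forall_compl_eq_zero (s := Ω) (f := fun x => φ x • gradAt p x)
        fun x hx => by rw [h0 x fun h' => hx (hUΩ h'), zero_smul],
      eq_neg_iff_add_eq_zero,
      setIntegral_eq_of_subset_of_forall_sdiff_eq_zero hΩ.measurableSet hUΩ
        (fun x hx => by rw [h0' x hx.2, smul_zero]),
      integral_congr_ae (g := fun x => evalAt p x • gradient φ x)
        (hp.mono fun x hx => by simp only [hx]),
      setIntegral_eq_integral_of_forall_compl_eq_zero fun x hx => by rw [h0' x hx, smul_zero],
      ← integral_add i3 i2, ← integral_gradient_eq_zero ((contDiff_evalAt p).mul hφ) hφs.mul_left]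
    refine integral_congr_ae (Eventually.of_forall fun x => ?_)
    simp only
    rw [gradient_mul (contDiff_evalAt p) hφ, gradient_evalAt]
  rw [ae_restrict_iff' hU.measurableSet]
  filter_upwards [key] with x hx hxU
  exact sub_eq_zero.1 (hx hxU)

/-! ### Triangles -/

/-- The vertices of a triangle as an affine basis of the plane. -/
noncomputable def vertexBasis (T : Triangle) : AffineBasis (Fin 3) ℝ Plane :=
  ⟨T.points, T.independent, by
    rw [T.independent.affineSpan_eq_top_iff_card_eq_finrank_add_one]; simp⟩

theorem mem_cell_iff (T : Triangle) (x : Plane) :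
    x ∈ cell T ↔ ∀ i, 0 ≤ (vertexBasis T).coord i x := by
  have h := (vertexBasis T).convexHull_eq_nonneg_coord
  exact Set.ext_iff.1 h x

theorem mem_interior_cell_iff (T : Triangle) (x : Plane) :
    x ∈ interior (cell T) ↔ ∀ i, 0 < (vertexBasis T).coord i x := by
  have h := (vertexBasis T).interior_convexHull
  exact Set.ext_iff.1 h x

theorem coord_le_one {T : Triangle} {x : Plane} (hx : x ∈ cell T) (i : Fin 3) :
    (vertexBasis T).coord i x ≤ 1 := by
  rw [← (vertexBasis T).sum_coord_apply_eq_one x]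
  exact Finset.single_le_sum (f := fun i => (vertexBasis T).coord i x)
    (fun j _ => (mem_cell_iff T x).1 hx j) (Finset.mem_univ i)

theorem isCompact_cell (T : Triangle) : IsCompact (cell T) :=
  (Set.finite_range _).isCompact_convexHull ℝ

theorem convex_cell (T : Triangle) : Convex ℝ (cell T) := convex_convexHull ℝ _

theorem measurableSet_cell (T : Triangle) : MeasurableSet (cell T) :=
  (isCompact_cell T).isClosed.measurableSet

theorem points_mem_cell (T : Triangle) (i : Fin 3) : T.points i ∈ cell T :=
  subset_convexHull ℝ _ ⟨i, rfl⟩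

theorem interior_cell_nonempty (T : Triangle) : (interior (cell T)).Nonempty :=
  interior_convexHull_nonempty_iff_affineSpan_eq_top.2 (vertexBasis T).tot

theorem interior_cell_ae_eq (T : Triangle) : interior (cell T) =ᵐ[volume] cell T :=
  interior_ae_eq_of_null_frontier ((convex_cell T).addHaar_frontier volume)

theorem dist_le_hT {T : Triangle} {x y : Plane} (hx : x ∈ cell T) (hy : y ∈ cell T) :
    dist x y ≤ hT T :=
  Metric.dist_le_diam_of_mem (isCompact_cell T).isBounded hx hy

theorem hT_pos (T : Triangle) : 0 < hT T :=
  (dist_pos.2 (T.independent.injective.ne (show (0 : Fin 3) ≠ 1 by decide))).trans_le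
    (dist_le_hT (points_mem_cell T 0) (points_mem_cell T 1))

/-- A barycentric coordinate stays in [0, 1] on the cell, while along a diameter of the ball
parallel to `y` it changes by d·|l(y)|/‖y‖, where l is its linear part. -/
theorem abs_linear_mul_le (T : Triangle) (i : Fin 3) {c : Plane} {d : ℝ}
    (hd : Metric.ball c (d / 2) ⊆ cell T) (y : Plane) :
    d * |((vertexBasis T).coord i).linear y| ≤ ‖y‖ := by
  set l := ((vertexBasis T).coord i) with hl
  rcases eq_or_ne y 0 with rfl | hy
  · simp
  have hy' : 0 < ‖y‖ := norm_pos_iff.2 hy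
  rcases le_or_gt d 0 with hd0 | hd0
  · exact (mul_nonpos_of_nonpos_of_nonneg hd0 (abs_nonneg _)).trans hy'.le
  refine le_of_forall_lt_imp_le_of_dense ?_
  intro e he
  by_contra! hcon
  obtain ⟨e', he1, he2⟩ := exists_between he
  have habs : 0 < |l.linear y| := by
    by_contra h0
    have : |l.linear y| = 0 := le_antisymm (not_lt.1 h0) (abs_nonneg _)
    rw [this, mul_zero] at he
    linarith
  set t := e' / (2 * ‖y‖ * |l.linear y|) with ht
  have htpos : 0 < t := by
    have : 0 < e' := by linarith
    positivity
  have ht2 : t * ‖y‖ < d / 2 := by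
    rw [ht, div_mul_eq_mul_div, div_lt_div_iff₀ (by positivity) (by norm_num)]
    nlinarith
  have hmem : ∀ s : ℝ, |s| = t → c + s • y ∈ cell T := fun s hs => hd (by
    rw [Metric.mem_ball, dist_eq_norm, add_sub_cancel_left, norm_smul, Real.norm_eq_abs, hs]
    exact ht2)
  have hval : ∀ s : ℝ, l (c + s • y) = l c + s * l.linear y := by
    intro s
    rw [add_comm, ← vadd_eq_add, l.map_vadd, map_smul]
    simp [add_comm]
  have h1 := hmem t (abs_of_pos htpos)
  have h2 := hmem (-t) (by rw [abs_neg, abs_of_pos htpos])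
  have a1 := (mem_cell_iff T _).1 h1 i
  have a2 := (mem_cell_iff T _).1 h2 i
  have b1 := coord_le_one h1 i
  have b2 := coord_le_one h2 i
  rw [← hl, hval] at a1 a2 b1 b2
  have hle : 2 * (t * |l.linear y|) ≤ 1 := by
    rcases abs_cases (l.linear y) with ⟨h, _⟩ | ⟨h, _⟩ <;> rw [h] <;> linarith
  have : 2 * (t * |l.linear y|) = e' / ‖y‖ := by
    rw [ht]; field_simp
  rw [this, div_le_one hy'] at hle
  linarith

theorem rhoT_mul_abs_linear_le (T : Triangle) (i : Fin 3) (y : Plane) :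
    rhoT T * |((vertexBasis T).coord i).linear y| ≤ ‖y‖ := by
  rcases (abs_nonneg (((vertexBasis T).coord i).linear y)).eq_or_lt with h | h
  · rw [← h]; simp
  rw [← le_div_iff₀ h]
  refine csSup_le ⟨0, 0, by simp⟩ ?_
  rintro d ⟨c, hd⟩
  rw [le_div_iff₀ h]
  exact abs_linear_mul_le T i hd y

theorem rhoT_pos {T : Triangle} {σ : ℝ} (h : hT T ≤ σ * rhoT T) : 0 < rhoT T := by
  have h0 : 0 ≤ rhoT T := by
    by_contra! hneg
    -- The supremum of an unbounded set is 0 by convention, which contradicts negativity. In the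
    -- bounded case, d = 0 is admissible because its ball is empty.
    have hb : BddAbove {d : ℝ | ∃ c : Plane, Metric.ball c (d / 2) ⊆ cell T} := by
      by_contra hb
      rw [rhoT, Real.sSup_of_not_bddAbove hb] at hneg
      exact lt_irrefl _ hneg
    have := le_csSup hb (a := 0) ⟨0, by simp⟩
    exact absurd (this.trans_lt hneg) (lt_irrefl _)
  refine lt_of_le_of_ne h0 fun h1 => ?_
  rw [← h1, mul_zero] at h
  exact absurd (hT_pos T) (not_lt.2 h)

theorem aspect_pos {T : Triangle} {σ : ℝ} (h : hT T ≤ σ * rhoT T) : 0 < σ :=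
  pos_of_mul_pos_left ((hT_pos T).trans_le h) (rhoT_pos h).le

/-- The supremum defining ρ_T need not be known to be attained, so a ball of diameter more than
ρ_T/2 is taken; its radius exceeds ρ_T/4 ≥ h_T/(4σ). -/
theorem exists_ball_subset_cell {T : Triangle} {σ : ℝ} (h : hT T ≤ σ * rhoT T) :
    ∃ c : Plane, Metric.ball c (hT T / (4 * σ)) ⊆ cell T := by
  have hρ := rhoT_pos h
  have hσ := aspect_pos h
  obtain ⟨d, ⟨c, hd⟩, hlt⟩ := exists_lt_of_lt_csSup
    (s := {d : ℝ | ∃ c : Plane, Metric.ball c (d / 2) ⊆ cell T})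
    ⟨0, 0, by simp⟩ (show rhoT T / 2 < rhoT T by linarith)
  refine ⟨c, (Metric.ball_subset_ball ?_).trans hd⟩
  rw [div_le_iff₀ (by positivity)]
  nlinarith

/-! ### Sides of an edge -/

/-- Near the midpoint of the edge from `P` to `Q`, the triangle `T` coincides with the half-plane
into which the normal vector `n` points. -/
structure IsSide (T : Triangle) (P Q n : Plane) : Prop where
  subset : ∀ x ∈ cell T, 0 ≤ inner ℝ (x - midpoint ℝ P Q) n
  mem_cell : ∀ x, ‖x - midpoint ℝ P Q‖ < rhoT T / 2 → 0 ≤ inner ℝ (x - midpoint ℝ P Q) n →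
    x ∈ cell T
  mem_interior : ∀ x, ‖x - midpoint ℝ P Q‖ < rhoT T / 2 → 0 < inner ℝ (x - midpoint ℝ P Q) n →
    x ∈ interior (cell T)
  mem_openSegment : ∀ x, ‖x - midpoint ℝ P Q‖ < rhoT T / 2 →
    inner ℝ (x - midpoint ℝ P Q) n = 0 → x ∈ openSegment ℝ P Q

theorem univ_fin_three : ∀ i j k : Fin 3, i ≠ j → i ≠ k → j ≠ k →
    (Finset.univ : Finset (Fin 3)) = {i, j, k} := by decide

/-- Decomposition of a vector along two orthonormal vectors. -/
theorem eq_inner_smul_add_inner_smul {τ n : Plane} (hτ : ‖τ‖ = 1) (hn : ‖n‖ = 1)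
    (hτn : inner ℝ τ n = 0) (d : Plane) : d = inner ℝ d τ • τ + inner ℝ d n • n :=
  (exists_measurePreserving_coords 0 τ n hτ hn hτn).2.2 d

/-- The coordinate `i` vanishes on the edge, hence is a multiple κ of the signed distance to its
line. The other two equal 1/2 at the midpoint and have slope at most 1/ρ_T, so they stay positive
within distance ρ_T/2, where the coordinate `i` alone decides membership. The sign of κ selects `n`
or `-n`. -/
theorem exists_isSide_of_points {T : Triangle} {i j k : Fin 3} (hij : i ≠ j) (hik : i ≠ k)
    (hjk : j ≠ k) (hρ : 0 < rhoT T) {n : Plane} (hn : ‖n‖ = 1)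
    (hPQ : inner ℝ (T.points k - T.points j) n = 0) :
    IsSide T (T.points j) (T.points k) n ∨ IsSide T (T.points j) (T.points k) (-n) := by
  set b := vertexBasis T with hb
  set P := T.points j with hP
  set Q := T.points k with hQ
  set m := midpoint ℝ P Q with hm
  have hbP : b j = P := rfl
  have hbQ : b k = Q := rfl
  have hne : Q - P ≠ 0 := sub_ne_zero.2 (T.independent.injective.ne hjk.symm)
  set τ := ‖Q - P‖⁻¹ • (Q - P) with hτdef
  have hτ : ‖τ‖ = 1 := by
    rw [hτdef, norm_smul, norm_inv, norm_norm, inv_mul_cancel₀ (norm_ne_zero_iff.2 hne)]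
  have hτn : inner ℝ τ n = 0 := by rw [hτdef, inner_smul_left, hPQ, mul_zero]
  have hlin : ∀ (a : Fin 3) (x y : Plane), b.coord a x = b.coord a y + (b.coord a).linear (x - y) := by
    intro a x y
    have := (b.coord a).linearMap_vsub x y
    simp only [vsub_eq_sub] at this
    rw [this]; ring
  have hmid : ∀ a, b.coord a m = (b.coord a P + b.coord a Q) / 2 := by
    intro a
    rw [hm, AffineMap.map_midpoint, midpoint_eq_smul_add]
    simp; ring
  have hiP : b.coord i P = 0 := by rw [← hbP, b.coord_apply_ne hij]
  have hiQ : b.coord i Q = 0 := by rw [← hbQ, b.coord_apply_ne hik]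
  have him : b.coord i m = 0 := by rw [hmid, hiP, hiQ]; norm_num
  have hjm : b.coord j m = 1 / 2 := by
    rw [hmid, ← hbP, ← hbQ, b.coord_apply_eq, b.coord_apply_ne hjk]; norm_num
  have hkm : b.coord k m = 1 / 2 := by
    rw [hmid, ← hbP, ← hbQ, b.coord_apply_eq, b.coord_apply_ne hjk.symm]; norm_num
  have hlτ : (b.coord i).linear τ = 0 := by
    have := hlin i Q P
    rw [hiP, hiQ, zero_add] at this
    rw [hτdef, map_smul, ← this, smul_zero]
  set κ := (b.coord i).linear n with hκ
  have hi : ∀ x, b.coord i x = inner ℝ (x - m) n * κ := by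
    intro x
    rw [hlin i x m, him, zero_add]
    conv_lhs => rw [eq_inner_smul_add_inner_smul hτ hn hτn (x - m)]
    rw [map_add, LinearMap.map_smul _ _ τ, LinearMap.map_smul _ _ n, hlτ, smul_zero, zero_add,
      smul_eq_mul]
  have hκ0 : κ ≠ 0 := by
    intro h0
    have := hi (b i)
    rw [b.coord_apply_eq, h0, mul_zero] at this
    exact one_ne_zero this
  have hpos : ∀ (a : Fin 3), b.coord a m = 1 / 2 → ∀ x, ‖x - m‖ < rhoT T / 2 →
      0 < b.coord a x := by
    intro a ha x hx
    rw [hlin a x m, ha]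
    have h1 := rhoT_mul_abs_linear_le T a (x - m)
    have h2 : |(b.coord a).linear (x - m)| < 1 / 2 := by
      by_contra! h3
      have := mul_le_mul_of_nonneg_left h3 hρ.le
      linarith
    linarith [(abs_lt.1 h2).1]
  have hall : ∀ p : Fin 3 → Prop, p i → p j → p k → ∀ a, p a := by
    intro p pi pj pk a
    have := Finset.mem_univ a
    rw [univ_fin_three i j k hij hik hjk] at this
    simp only [Finset.mem_insert, Finset.mem_singleton] at this
    rcases this with rfl | rfl | rfl <;> assumption
  -- ε is the sign ±1 that makes ε·n point into the triangle.
  have main : ∀ ε : ℝ, 0 < ε * κ → ε * ε = 1 → IsSide T P Q (ε • n) := by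
    intro ε hε hε1
    have hε' : ∀ x, inner ℝ (x - m) (ε • n) * (ε * κ) = b.coord i x := by
      intro x
      rw [inner_smul_right, hi]
      linear_combination (inner ℝ (x - m) n * κ) * hε1
    constructor
    · intro x hx
      have := (mem_cell_iff T x).1 hx i
      rw [← hb, ← hε'] at this
      exact nonneg_of_mul_nonneg_left this hε
    · intro x hx h0
      rw [mem_cell_iff]
      refine hall _ ?_ (hpos j hjm x hx).le (hpos k hkm x hx).le
      rw [← hb, ← hε']
      exact mul_nonneg h0 hε.le
    · intro x hx h0
      rw [mem_interior_cell_iff]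
      refine hall _ ?_ (hpos j hjm x hx) (hpos k hkm x hx)
      rw [← hb, ← hε']
      exact mul_pos h0 hε
    · intro x hx h0
      have hx0 : b.coord i x = 0 := by rw [← hε', h0, zero_mul]
      have hsum := b.sum_coord_apply_eq_one x
      have hcomb := b.linear_combination_coord_eq_self x
      rw [univ_fin_three i j k hij hik hjk] at hsum hcomb
      rw [Finset.sum_insert (by simp [hij, hik]), Finset.sum_pair hjk, hx0] at hsum hcomb
      rw [zero_add] at hsum
      rw [zero_smul, zero_add] at hcomb
      exact ⟨_, _, hpos j hjm x hx, hpos k hkm x hx, hsum, hcomb⟩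
  rcases lt_or_gt_of_ne hκ0 with h | h
  · right
    have := main (-1) (by linarith) (by norm_num)
    simpa using this
  · left
    have := main 1 (by linarith) (by norm_num)
    simpa using this

theorem exists_isSide {T : Triangle} {P Q : Plane} (hPT : P ∈ Set.range T.points)
    (hQT : Q ∈ Set.range T.points) (hne : P ≠ Q) (hρ : 0 < rhoT T) {n : Plane} (hn : ‖n‖ = 1)
    (hPQ : inner ℝ (Q - P) n = 0) : IsSide T P Q n ∨ IsSide T P Q (-n) := by
  obtain ⟨j, rfl⟩ := hPT
  obtain ⟨k, rfl⟩ := hQT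
  have hjk : j ≠ k := fun h => hne (by rw [h])
  have : ∀ j k : Fin 3, j ≠ k → ∃ i, i ≠ j ∧ i ≠ k := by decide
  obtain ⟨i, hij, hik⟩ := this j k hjk
  exact exists_isSide_of_points hij hik hjk hρ hn hPQ

theorem norm_unitNormal {P Q : Plane} (h : P ≠ Q) : ‖unitNormal P Q‖ = 1 := by
  have h0 : 0 < ‖Q - P‖ := norm_pos_iff.2 (sub_ne_zero.2 h.symm)
  have h1 : ‖(!₂[Q 1 - P 1, P 0 - Q 0] : Plane)‖ = ‖Q - P‖ := by
    rw [← sq_eq_sq₀ (norm_nonneg _) (norm_nonneg _), norm_sq_plane, norm_sq_plane]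
    simp; ring
  rw [unitNormal, norm_smul, h1, norm_inv, norm_norm, inv_mul_cancel₀ h0.ne']

theorem inner_sub_unitNormal (P Q : Plane) : inner ℝ (Q - P) (unitNormal P Q) = 0 := by
  rw [unitNormal, inner_smul_right, inner_plane]
  simp; right; ring

variable {Ω : Set Plane}

/-- Two different triangles with a common edge lie on different sides of it. -/
theorem Triangulation.isSide_ne (𝒯 : Triangulation Ω) {T T' : Triangle} (hT : T ∈ 𝒯.cells)
    (hT' : T' ∈ 𝒯.cells) (hTT' : T ≠ T') {P Q n : Plane} (hn : ‖n‖ = 1)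
    (hPQ : inner ℝ (Q - P) n = 0) (hne : P ≠ Q)
    (hP : P ∈ Set.range T.points) (hQ : Q ∈ Set.range T.points)
    (hP' : P ∈ Set.range T'.points) (hQ' : Q ∈ Set.range T'.points)
    (hρ : 0 < rhoT T) (hρ' : 0 < rhoT T') (h : IsSide T P Q n) : ¬ IsSide T' P Q n := by
  intro h'
  have hcard : ∀ S : Triangle, (Set.range S.points).ncard = 3 := fun S => by
    rw [Set.ncard_range_of_injective S.independent.injective]; simp
  have hfin : ∀ S : Triangle, (Set.range S.points).Finite := fun S => Set.finite_range _
  -- Three common vertices would force the triangles to be equal, so P and Q are the only ones.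
  have hsub : Set.range T.points ∩ Set.range T'.points ⊆ {P, Q} := by
    have h2 : ({P, Q} : Set Plane).ncard = 2 := Set.ncard_pair hne
    have hle : (Set.range T.points ∩ Set.range T'.points).ncard ≤ 2 := by
      by_contra! hlt
      have e1 := Set.eq_of_subset_of_ncard_le (s := Set.range T.points ∩ Set.range T'.points)
        Set.inter_subset_left (by rw [hcard]; omega) (hfin T)
      have e2 := Set.eq_of_subset_of_ncard_le (s := Set.range T.points ∩ Set.range T'.points)
        Set.inter_subset_right (by rw [hcard]; omega) (hfin T')
      exact hTT' (𝒯.eq_of_range_eq T hT T' hT' (e1.symm.trans e2))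
    refine (Set.eq_of_subset_of_ncard_le (s := {P, Q}) ?_ (by omega)
      ((hfin T).inter_of_left _)).ge
    rintro x (rfl | rfl)
    · exact ⟨hP, hP'⟩
    · exact ⟨hQ, hQ'⟩
  set m := midpoint ℝ P Q with hm
  have hmP : inner ℝ (P - m) n = 0 := by
    rw [hm, left_sub_midpoint, inner_smul_left, ← neg_sub, inner_neg_left, hPQ]; simp
  have hmQ : inner ℝ (Q - m) n = 0 := by
    rw [hm, right_sub_midpoint, inner_smul_left, hPQ]; simp
  obtain ⟨ε, hε, hε1⟩ := exists_between (lt_min hρ hρ')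
  have hε2 := lt_min_iff.1 hε1
  -- If both triangles lay on the side of `n`, this point off the edge line would be common to them.
  -- Conformity places it in the hull of P and Q, hence on that line.
  have hx : m + (ε / 2) • n ∈ cell T ∩ cell T' := by
    have e1 : inner ℝ (m + (ε / 2) • n - m) n = ε / 2 := by
      rw [add_sub_cancel_left, inner_smul_left, real_inner_self_eq_norm_sq, hn]; simp
    have e2 : ‖m + (ε / 2) • n - m‖ = ε / 2 := by
      rw [add_sub_cancel_left, norm_smul, hn, mul_one, Real.norm_of_nonneg (by positivity)]
    constructor
    · exact h.mem_cell _ (by rw [e2]; linarith) (by rw [e1]; positivity)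
    · exact h'.mem_cell _ (by rw [e2]; linarith) (by rw [e1]; positivity)
  rw [𝒯.conforming T hT T' hT'] at hx
  have hconv : Convex ℝ {x : Plane | inner ℝ (x - m) n ≤ 0} := by
    have : {x : Plane | inner ℝ (x - m) n ≤ 0} = {x : Plane | inner ℝ n x ≤ inner ℝ n m} := by
      ext x
      rw [Set.mem_ofPred_eq, Set.mem_ofPred_eq, real_inner_comm, inner_sub_right, sub_nonpos]
    rw [this]
    exact convex_halfSpace_le (innerSL ℝ n).toLinearMap.isLinear _
  have hle := convexHull_min (t := {x : Plane | inner ℝ (x - m) n ≤ 0}) (fun x hx => by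
    rcases hsub hx with rfl | rfl
    · exact hmP.le
    · exact hmQ.le) hconv hx
  rw [Set.mem_ofPred_eq, add_sub_cancel_left, inner_smul_left, real_inner_self_eq_norm_sq, hn] at hle
  simp at hle
  linarith

theorem edgeFst_ne_edgeSnd (T : Triangle) (i : Fin 3) : edgeFst T i ≠ edgeSnd T i := by
  refine T.independent.injective.ne ?_
  fin_cases i <;> decide

/-- An edge has at most one triangle on its other side. -/
theorem Triangulation.isNeighbour_unique (𝒯 : Triangulation Ω) {σ : ℝ} (hσ : 𝒯.IsRegular σ)
    {T T₁ T₂ : Triangle} {i : Fin 3} (hT : T ∈ 𝒯.cells) (hT₁ : T₁ ∈ 𝒯.cells)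
    (hT₂ : T₂ ∈ 𝒯.cells) (h₁ : IsNeighbour T i T₁) (h₂ : IsNeighbour T i T₂) : T₁ = T₂ := by
  by_contra hne
  have hPQ := edgeFst_ne_edgeSnd T i
  have hn := norm_unitNormal hPQ
  have hin := inner_sub_unitNormal (edgeFst T i) (edgeSnd T i)
  have hP : edgeFst T i ∈ Set.range T.points := ⟨_, rfl⟩
  have hQ : edgeSnd T i ∈ Set.range T.points := ⟨_, rfl⟩
  have ρ := rhoT_pos (hσ T hT)
  have ρ₁ := rhoT_pos (hσ T₁ hT₁)
  have ρ₂ := rhoT_pos (hσ T₂ hT₂)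
  have hn' : ‖-unitNormal (edgeFst T i) (edgeSnd T i)‖ = 1 := by rw [norm_neg, hn]
  have hin' : inner ℝ (edgeSnd T i - edgeFst T i) (-unitNormal (edgeFst T i) (edgeSnd T i)) = 0 := by
    rw [inner_neg_right, hin, neg_zero]
  -- Pigeonhole: of three different triangles sharing the edge, two lie on the same side.
  rcases exists_isSide hP hQ hPQ ρ hn hin with s | s <;>
  rcases exists_isSide h₁.2.1 h₁.2.2 hPQ ρ₁ hn hin with s₁ | s₁ <;>
  rcases exists_isSide h₂.2.1 h₂.2.2 hPQ ρ₂ hn hin with s₂ | s₂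
  · exact 𝒯.isSide_ne hT hT₁ h₁.1.symm hn hin hPQ hP hQ h₁.2.1 h₁.2.2 ρ ρ₁ s s₁
  · exact 𝒯.isSide_ne hT hT₁ h₁.1.symm hn hin hPQ hP hQ h₁.2.1 h₁.2.2 ρ ρ₁ s s₁
  · exact 𝒯.isSide_ne hT hT₂ h₂.1.symm hn hin hPQ hP hQ h₂.2.1 h₂.2.2 ρ ρ₂ s s₂
  · exact 𝒯.isSide_ne hT₁ hT₂ hne hn' hin' hPQ h₁.2.1 h₁.2.2 h₂.2.1 h₂.2.2 ρ₁ ρ₂ s₁ s₂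
  · exact 𝒯.isSide_ne hT₁ hT₂ hne hn hin hPQ h₁.2.1 h₁.2.2 h₂.2.1 h₂.2.2 ρ₁ ρ₂ s₁ s₂
  · exact 𝒯.isSide_ne hT hT₂ h₂.1.symm hn' hin' hPQ hP hQ h₂.2.1 h₂.2.2 ρ ρ₂ s s₂
  · exact 𝒯.isSide_ne hT hT₁ h₁.1.symm hn' hin' hPQ hP hQ h₁.2.1 h₁.2.2 ρ ρ₁ s s₁
  · exact 𝒯.isSide_ne hT hT₁ h₁.1.symm hn' hin' hPQ hP hQ h₁.2.1 h₁.2.2 ρ ρ₁ s s₁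

/-! ### The `L²`-norm -/

theorem l2norm_nonneg {F : Type*} [NormedAddCommGroup F] (D : Set Plane) (w : Plane → F) :
    0 ≤ l2norm D w := Real.sqrt_nonneg _

theorem volume_real_ball_plane (c : Plane) {h : ℝ} (hh : 0 ≤ h) :
    volume.real (Metric.ball c h) = Real.pi * h ^ 2 := by
  rw [Measure.real, EuclideanSpace.volume_ball_fin_two, ENNReal.toReal_mul, ENNReal.toReal_pow,
    ENNReal.toReal_ofReal hh, ENNReal.toReal_ofReal Real.pi_pos.le, mul_comm]

/-- The Cauchy–Schwarz inequality for a bounded function with small support. -/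
theorem abs_setIntegral_inner_le {F : Type*} [NormedAddCommGroup F] [InnerProductSpace ℝ F]
    {D : Set Plane} {g w : Plane → F} (hg : MemLp g 2 (volume.restrict D)) (hw : Continuous w)
    {c : Plane} {h K : ℝ} (hh : 0 ≤ h) (hK : 0 ≤ K) (hwK : ∀ x, ‖w x‖ ≤ K)
    (hw0 : ∀ x, x ∉ Metric.ball c h → w x = 0) :
    |∫ x in D, inner ℝ (g x) (w x)| ≤ Real.sqrt Real.pi * h * (K * l2norm D g) := by
  have hws : HasCompactSupport w := HasCompactSupport.intro (isCompact_closedBall c h)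
    fun x hx => hw0 x fun hx' => hx (Metric.ball_subset_closedBall hx')
  have hw2 : MemLp w 2 volume := hw.memLp_of_hasCompactSupport hws
  have hw2' : MemLp w 2 (volume.restrict D) := hw2.restrict D
  have hint : Integrable (fun x => ‖g x‖ * ‖w x‖) (volume.restrict D) :=
    hg.norm.integrable_mul hw2'.norm
  have h1 : |∫ x in D, inner ℝ (g x) (w x)| ≤ ∫ x in D, ‖g x‖ * ‖w x‖ := by
    rw [← Real.norm_eq_abs]
    exact norm_integral_le_of_norm_le hint (Eventually.of_forall fun x => norm_inner_le_norm _ _)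
  have h2 : ∫ x in D, ‖g x‖ * ‖w x‖ ≤ l2norm D g * l2norm D w := by
    have := integral_mul_le_Lp_mul_Lq_of_nonneg (μ := volume.restrict D)
      Real.HolderConjugate.two_two (f := fun x => ‖g x‖) (g := fun x => ‖w x‖)
      (Eventually.of_forall fun x => norm_nonneg _) (Eventually.of_forall fun x => norm_nonneg _)
      (by simpa using hg.norm) (by simpa using hw2'.norm)
    simpa [l2norm, Real.sqrt_eq_rpow] using this
  -- The support of `w` lies in a ball of area πh².
  have h3 : l2norm D w ≤ Real.sqrt Real.pi * h * K := by
    refine Real.sqrt_le_iff.2 ⟨by positivity, ?_⟩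
    have hw2i : Integrable (fun x => ‖w x‖ ^ 2) := hw2.integrable_norm_pow (by norm_num)
    calc ∫ x in D, ‖w x‖ ^ 2 ≤ ∫ x, ‖w x‖ ^ 2 :=
          setIntegral_le_integral hw2i (Eventually.of_forall fun x => by positivity)
      _ = ∫ x in Metric.ball c h, ‖w x‖ ^ 2 :=
          (setIntegral_eq_integral_of_forall_compl_eq_zero fun x hx => by simp [hw0 x hx]).symm
      _ ≤ ∫ x in Metric.ball c h, K ^ 2 :=
          integral_mono hw2i.integrableOn
            (integrableOn_const measure_ball_lt_top.ne)
            fun x => by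
              have := hwK x
              gcongr
      _ = (Real.sqrt Real.pi * h * K) ^ 2 := by
          rw [setIntegral_const, volume_real_ball_plane c hh, mul_pow, mul_pow,
            Real.sq_sqrt Real.pi_pos.le, smul_eq_mul]
  calc _ ≤ l2norm D g * l2norm D w := h1.trans h2
    _ ≤ l2norm D g * (Real.sqrt Real.pi * h * K) :=
        mul_le_mul_of_nonneg_left h3 (l2norm_nonneg _ _)
    _ = _ := by ring

/-- For integrands supported in a small ball, this exchanges Ω for the cells it meets there, or a
cell for a half-plane. -/
theorem setIntegral_congr_of_forall_mem_iff {E : Type*} [NormedAddCommGroup E] [NormedSpace ℝ E]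
    {S S' B : Set Plane} (hS : MeasurableSet S) (hS' : MeasurableSet S') {F : Plane → E}
    (hF : ∀ x, x ∉ B → F x = 0) (h : ∀ x ∈ B, x ∈ S ↔ x ∈ S') :
    ∫ x in S, F x = ∫ x in S', F x := by
  rw [← integral_indicator hS, ← integral_indicator hS']
  congr 1
  ext x
  by_cases hx : x ∈ B
  · by_cases hxS : x ∈ S
    · rw [Set.indicator_of_mem hxS, Set.indicator_of_mem ((h x hx).1 hxS)]
    · rw [Set.indicator_of_notMem hxS, Set.indicator_of_notMem (mt (h x hx).2 hxS)]
  · simp [Set.indicator, hF x hx]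

theorem setIntegral_closedBall_comp (c : Plane) {h : ℝ} (hh : 0 < h) (r : ℝ) (g : Plane → ℝ) :
    ∫ x in Metric.closedBall c (h * r), g x =
      h ^ 2 * ∫ y in Metric.closedBall (0 : Plane) r, g (c + h • y) := by
  rw [← integral_indicator Metric.isClosed_closedBall.measurableSet,
    ← integral_indicator Metric.isClosed_closedBall.measurableSet]
  have h1 := Measure.integral_comp_smul (volume : Measure Plane)
    (fun z => (Metric.closedBall c (h * r)).indicator g (c + z)) h
  rw [integral_add_left_eq_self (μ := (volume : Measure Plane))] at h1
  have h2 : ∀ y : Plane, (Metric.closedBall (0 : Plane) r).indicator (fun y => g (c + h • y)) y =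
      (Metric.closedBall c (h * r)).indicator g (c + h • y) := by
    intro y
    have : c + h • y ∈ Metric.closedBall c (h * r) ↔ y ∈ Metric.closedBall (0 : Plane) r := by
      rw [Metric.mem_closedBall, mem_closedBall_zero_iff, dist_eq_norm, add_sub_cancel_left,
        norm_smul, Real.norm_of_nonneg hh.le, mul_le_mul_iff_right₀ hh]
    by_cases hy : y ∈ Metric.closedBall (0 : Plane) r
    · rw [Set.indicator_of_mem hy, Set.indicator_of_mem (this.2 hy)]
    · rw [Set.indicator_of_notMem hy, Set.indicator_of_notMem (mt this.1 hy)]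
  simp_rw [h2]
  rw [h1, finrank_euclideanSpace_fin, abs_of_pos (by positivity), smul_eq_mul]
  field_simp

/-! ### Smooth cut-off functions -/

theorem gradient_comp_affine {g : Plane → ℝ} (hg : ContDiff ℝ ∞ g) (c : Plane) (h : ℝ)
    (y : Plane) : gradient (fun y => g (c + h • y)) y = h • gradient g (c + h • y) := by
  have h1 : HasFDerivAt (fun y : Plane => c + h • y) (h • ContinuousLinearMap.id ℝ Plane) y :=
    ((hasFDerivAt_id y).const_smul h).const_add c
  have h2 := ((hg.differentiable (by simp) (c + h • y)).hasFDerivAt).comp y h1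
  have h3 : fderiv ℝ (fun y => g (c + h • y)) y =
      h • fderiv ℝ g (c + h • y) := by
    rw [show (fun y => g (c + h • y)) = g ∘ fun y => c + h • y from rfl, h2.fderiv]
    ext z; simp
  simp only [gradient, h3]
  simp

/-- A smooth cut-off function, with a bound `D` for its gradient. -/
structure IsCutoff (b : Plane → ℝ) (δ D : ℝ) : Prop where
  contDiff : ContDiff ℝ ∞ b
  nonneg : ∀ x, 0 ≤ b x
  le_one : ∀ x, b x ≤ 1
  eq_one : ∀ x, ‖x‖ ≤ δ → b x = 1
  eq_zero : ∀ x, 2 * δ ≤ ‖x‖ → b x = 0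
  bound_nonneg : 0 ≤ D
  norm_gradient_le : ∀ x, ‖gradient b x‖ ≤ D

theorem exists_isCutoff {δ : ℝ} (hδ : 0 < δ) : ∃ b D, IsCutoff b δ D := by
  let b : ContDiffBump (0 : Plane) := ⟨δ, 2 * δ, hδ, by linarith⟩
  have hg := continuous_gradient (v := b) b.contDiff
  obtain ⟨D, hD⟩ := hg.bounded_above_of_compact_support
    (HasCompactSupport.gradient b.hasCompactSupport)
  exact ⟨b, D, b.contDiff, fun x => b.nonneg, fun x => b.le_one,
    fun x hx => b.one_of_mem_closedBall (by simpa using hx),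
    fun x hx => b.zero_of_le_dist (by simpa using hx), (norm_nonneg _).trans (hD 0), hD⟩

/-- The product of a function `w` with a cut-off function, scaled to a ball of radius `h`. -/
noncomputable def bubble (b : Plane → ℝ) (c : Plane) (h : ℝ) (w : Plane → ℝ) (x : Plane) : ℝ :=
  b (h⁻¹ • (x - c)) * w x

/-- `v` is a smooth function with support in a ball of radius `h`, and `K₀`, `K₁` bound its values
and its gradient. -/
structure IsLocalTest (v : Plane → ℝ) (c : Plane) (h K₀ K₁ : ℝ) : Prop where
  contDiff : ContDiff ℝ ∞ v
  tsupport_subset : tsupport v ⊆ Metric.ball c h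
  abs_le : ∀ x, |v x| ≤ K₀
  norm_gradient_le : ∀ x, ‖gradient v x‖ ≤ K₁

namespace IsLocalTest

variable {v : Plane → ℝ} {c : Plane} {h K₀ K₁ : ℝ}

theorem hasCompactSupport (hv : IsLocalTest v c h K₀ K₁) : HasCompactSupport v :=
  (isCompact_closedBall c h).of_isClosed_subset (isClosed_tsupport v)
    (hv.tsupport_subset.trans Metric.ball_subset_closedBall)

theorem eq_zero (hv : IsLocalTest v c h K₀ K₁) {x : Plane} (hx : x ∉ Metric.ball c h) : v x = 0 :=
  image_eq_zero_of_notMem_tsupport fun h' => hx (hv.tsupport_subset h')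

theorem gradient_eq_zero (hv : IsLocalTest v c h K₀ K₁) {x : Plane} (hx : x ∉ Metric.ball c h) :
    gradient v x = 0 :=
  image_eq_zero_of_notMem_tsupport fun h' =>
    hx (hv.tsupport_subset (tsupport_gradient_subset v h'))

theorem nonneg₀ (hv : IsLocalTest v c h K₀ K₁) : 0 ≤ K₀ := (abs_nonneg _).trans (hv.abs_le 0)

theorem nonneg₁ (hv : IsLocalTest v c h K₀ K₁) : 0 ≤ K₁ :=
  (norm_nonneg _).trans (hv.norm_gradient_le 0)

theorem isTestFunction (hv : IsLocalTest v c h K₀ K₁) {Ω : Set Plane}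
    (hΩ : Metric.ball c h ⊆ Ω) : IsTestFunction Ω v :=
  ⟨hv.contDiff, hv.hasCompactSupport, hv.tsupport_subset.trans hΩ⟩

end IsLocalTest

/-- By the product rule, both gradient terms scale like h⁻¹. The support lies in the closed ball of
radius 2δh, so the open ball of radius 4δh leaves room, and 4δ ≤ 1 keeps the support where the
bounds on `w` apply. -/
theorem IsCutoff.isLocalTest_bubble {b : Plane → ℝ} {δ D : ℝ} (hb : IsCutoff b δ D)
    (hδ : 0 < δ) (hδ' : 4 * δ ≤ 1) {c : Plane} {h K : ℝ} (hh : 0 < h) {w : Plane → ℝ}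
    (hw : ContDiff ℝ ∞ w) (hwK : ∀ x, ‖x - c‖ ≤ h → |w x| ≤ K)
    (hwK' : ∀ x, ‖x - c‖ ≤ h → ‖gradient w x‖ ≤ h⁻¹ * K) :
    IsLocalTest (bubble b c h w) c (h * (4 * δ)) K (h⁻¹ * ((D + 1) * K)) := by
  have hK : 0 ≤ K := (abs_nonneg _).trans (hwK c (by simpa using hh.le))
  have hD := hb.bound_nonneg
  have hsub : tsupport (bubble b c h w) ⊆ Metric.closedBall c (h * (2 * δ)) := by
    refine closure_minimal (fun x hx => ?_) Metric.isClosed_closedBall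
    by_contra hx'
    rw [Metric.mem_closedBall, dist_eq_norm, not_le] at hx'
    refine hx ?_
    rw [bubble, hb.eq_zero _ ?_, zero_mul]
    rw [norm_smul, norm_inv, Real.norm_of_nonneg hh.le, inv_mul_eq_div, le_div_iff₀ hh]
    linarith
  have hb' : ContDiff ℝ ∞ fun x => b (h⁻¹ • (x - c)) := hb.contDiff.comp (by fun_prop)
  have hin : ∀ x ∈ Metric.closedBall c (h * (2 * δ)), ‖x - c‖ ≤ h := fun x hx => by
    rw [Metric.mem_closedBall, dist_eq_norm] at hx
    nlinarith
  have haff : (fun x => b (h⁻¹ • (x - c))) = fun x => b (-(h⁻¹ • c) + h⁻¹ • x) := by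
    funext x; rw [smul_sub]; congr 1; abel
  refine ⟨hb'.mul hw, hsub.trans ?_, fun x => ?_, fun x => ?_⟩
  · exact Metric.closedBall_subset_ball (by nlinarith)
  · by_cases hx : x ∈ tsupport (bubble b c h w)
    · rw [bubble, abs_mul, abs_of_nonneg (hb.nonneg _)]
      have h1 := hb.le_one (h⁻¹ • (x - c))
      have h2 := hwK x (hin x (hsub hx))
      calc _ ≤ 1 * |w x| := by gcongr
        _ ≤ K := by linarith
    · rw [image_eq_zero_of_notMem_tsupport hx, abs_zero]; exact hK
  · by_cases hx : x ∈ tsupport (bubble b c h w)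
    · have h2 := hwK x (hin x (hsub hx))
      have h3 := hwK' x (hin x (hsub hx))
      have h4 := hb.norm_gradient_le (-(h⁻¹ • c) + h⁻¹ • x)
      have h5 := hb.le_one (h⁻¹ • (x - c))
      have h6 : gradient (bubble b c h w) x = b (h⁻¹ • (x - c)) • gradient w x +
          w x • h⁻¹ • gradient b (-(h⁻¹ • c) + h⁻¹ • x) := by
        rw [show bubble b c h w = fun x => b (h⁻¹ • (x - c)) * w x from rfl, gradient_mul hb' hw,
          haff, gradient_comp_affine hb.contDiff]
      rw [h6]
      refine (norm_add_le _ _).trans ?_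
      rw [norm_smul, norm_smul, norm_smul, Real.norm_of_nonneg (hb.nonneg _), Real.norm_eq_abs,
        norm_inv, Real.norm_of_nonneg hh.le]
      calc _ ≤ 1 * (h⁻¹ * K) + K * (h⁻¹ * D) := by gcongr
        _ = _ := by ring
    · rw [image_eq_zero_of_notMem_tsupport fun h' => hx (tsupport_gradient_subset _ h'), norm_zero]
      positivity

/-! ### The residual on one triangle -/

/-- The polynomial `f_T + div (a ∇u_h)` on a triangle. -/
noncomputable def residual (α : ℝ) (q p : MvPolynomial (Fin 2) ℝ) : MvPolynomial (Fin 2) ℝ :=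
  q + MvPolynomial.C α * (MvPolynomial.pderiv 0 (MvPolynomial.pderiv 0 p) +
    MvPolynomial.pderiv 1 (MvPolynomial.pderiv 1 p))

theorem evalAt_residual (α : ℝ) (q p : MvPolynomial (Fin 2) ℝ) (x : Plane) :
    evalAt (residual α q p) x = evalAt q x + α * laplAt p x := by
  simp [residual, evalAt, laplAt]

theorem totalDegree_residual_le {α : ℝ} {q p : MvPolynomial (Fin 2) ℝ} {k : ℕ}
    (hq : q.totalDegree ≤ k) (hp : p.totalDegree ≤ k) : (residual α q p).totalDegree ≤ k := by
  refine (MvPolynomial.totalDegree_add _ _).trans (max_le hq ?_)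
  refine (MvPolynomial.totalDegree_mul _ _).trans ?_
  rw [MvPolynomial.totalDegree_C, zero_add]
  have h : ∀ i, (MvPolynomial.pderiv i (MvPolynomial.pderiv i p)).totalDegree ≤ k := fun i =>
    (totalDegree_pderiv_le i _).trans ((totalDegree_pderiv_le i p).trans hp)
  exact (MvPolynomial.totalDegree_add _ _).trans (max_le (h 0) (h 1))

/-- The data of the local estimates: `gu` is the gradient of a weak solution, and `guh` is piecewise
the gradient of the polynomials `p T`. -/
structure IsResidualSetting {Ω : Set Plane} (𝒯 : Triangulation Ω) (k : ℕ) (σ M : ℝ)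
    (a f : Plane → ℝ) (aT : Triangle → ℝ) (fT p : Triangle → MvPolynomial (Fin 2) ℝ)
    (gu guh : Plane → Plane) : Prop where
  isOpen : IsOpen Ω
  regular : 𝒯.IsRegular σ
  abs_le : ∀ T ∈ 𝒯.cells, |aT T| ≤ M
  a_eq : ∀ T ∈ 𝒯.cells, ∀ᵐ x ∂volume.restrict (cell T), a x = aT T
  memLp_f : MemLp f 2 (volume.restrict Ω)
  memLp_gu : MemLp gu 2 (volume.restrict Ω)
  memLp_guh : MemLp guh 2 (volume.restrict Ω)
  weak : ∀ φ : Plane → ℝ, IsTestFunction Ω φ →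
    ∫ x in Ω, a x * inner ℝ (gu x) (gradient φ x) = ∫ x in Ω, f x * φ x
  guh_eq : ∀ T ∈ 𝒯.cells, ∀ᵐ x ∂volume.restrict (cell T), guh x = gradAt (p T) x
  degree_f : ∀ T ∈ 𝒯.cells, (fT T).totalDegree ≤ k
  degree_p : ∀ T ∈ 𝒯.cells, (p T).totalDegree ≤ k

variable {Ω : Set Plane} {𝒯 : Triangulation Ω} {k : ℕ} {σ M : ℝ} {a f : Plane → ℝ}
  {aT : Triangle → ℝ} {fT p : Triangle → MvPolynomial (Fin 2) ℝ} {gu guh : Plane → Plane}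
  {T : Triangle}

theorem restrict_interior_cell (T : Triangle) :
    (volume : Measure Plane).restrict (interior (cell T)) = volume.restrict (cell T) :=
  Measure.restrict_congr_set (interior_cell_ae_eq T)

theorem Triangulation.memLp_cell {F : Type*} [NormedAddCommGroup F] (𝒯 : Triangulation Ω)
    (hT : T ∈ 𝒯.cells) {w : Plane → F} (hw : MemLp w 2 (volume.restrict Ω)) :
    MemLp w 2 (volume.restrict (cell T)) := by
  rw [← restrict_interior_cell]
  exact hw.mono_measure (Measure.restrict_mono_set _ (𝒯.interior_subset T hT))

theorem integrable_inner_of_memLp {F : Type*} [NormedAddCommGroup F] [InnerProductSpace ℝ F]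
    {μ : Measure Plane} {g w : Plane → F} (hg : MemLp g 2 μ) (hw : MemLp w 2 μ) :
    Integrable (fun x => inner ℝ (g x) (w x)) μ :=
  (hg.norm.integrable_mul hw.norm).mono' (hg.1.inner hw.1)
    (Eventually.of_forall fun _ => norm_inner_le_norm _ _)

namespace IsLocalTest

variable {v : Plane → ℝ} {c : Plane} {h K₀ K₁ : ℝ}

theorem memLp (hv : IsLocalTest v c h K₀ K₁) (μ : Measure Plane) [IsFiniteMeasureOnCompacts μ] :
    MemLp v 2 μ :=
  hv.contDiff.continuous.memLp_of_hasCompactSupport hv.hasCompactSupport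

theorem memLp_gradient (hv : IsLocalTest v c h K₀ K₁) (μ : Measure Plane)
    [IsFiniteMeasureOnCompacts μ] : MemLp (gradient v) 2 μ :=
  (continuous_gradient hv.contDiff).memLp_of_hasCompactSupport
    (HasCompactSupport.gradient hv.hasCompactSupport)

theorem integrable_mul (hv : IsLocalTest v c h K₀ K₁) {μ : Measure Plane}
    [IsFiniteMeasureOnCompacts μ] {g : Plane → ℝ} (hg : MemLp g 2 μ) :
    Integrable (fun x => g x * v x) μ :=
  hg.integrable_mul (hv.memLp μ)

theorem integrable_inner (hv : IsLocalTest v c h K₀ K₁) {μ : Measure Plane}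
    [IsFiniteMeasureOnCompacts μ] {g : Plane → Plane} (hg : MemLp g 2 μ) :
    Integrable (fun x => inner ℝ (g x) (gradient v x)) μ :=
  integrable_inner_of_memLp hg (hv.memLp_gradient μ)

theorem integrable_continuous_mul (hv : IsLocalTest v c h K₀ K₁) (μ : Measure Plane)
    [IsFiniteMeasureOnCompacts μ] {g : Plane → ℝ} (hg : Continuous g) :
    Integrable (fun x => g x * v x) μ :=
  (hg.mul hv.contDiff.continuous).integrable_of_hasCompactSupport hv.hasCompactSupport.mul_left

theorem integrable_green (hv : IsLocalTest v c h K₀ K₁) (μ : Measure Plane)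
    [IsFiniteMeasureOnCompacts μ] (p : MvPolynomial (Fin 2) ℝ) :
    Integrable (fun x => inner ℝ (gradAt p x) (gradient v x) + laplAt p x * v x) μ := by
  refine Integrable.add ?_ (hv.integrable_continuous_mul μ (continuous_laplAt p))
  refine ((continuous_gradAt p).inner
    (continuous_gradient hv.contDiff)).integrable_of_hasCompactSupport ?_
  refine (HasCompactSupport.gradient hv.hasCompactSupport).mono fun x hx => ?_
  contrapose! hx
  simp only [Function.notMem_support] at hx ⊢
  rw [hx, inner_zero_right]

theorem abs_setIntegral_mul_le (hv : IsLocalTest v c h K₀ K₁) (hh : 0 ≤ h) {D : Set Plane}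
    {g : Plane → ℝ} (hg : MemLp g 2 (volume.restrict D)) :
    |∫ x in D, g x * v x| ≤ Real.sqrt Real.pi * h * (K₀ * l2norm D g) := by
  have := abs_setIntegral_inner_le hg hv.contDiff.continuous hh hv.nonneg₀ hv.abs_le
    fun _ => hv.eq_zero
  simpa [mul_comm] using this

theorem abs_setIntegral_inner_gradient_le (hv : IsLocalTest v c h K₀ K₁) (hh : 0 ≤ h)
    {D : Set Plane} {g : Plane → Plane} (hg : MemLp g 2 (volume.restrict D)) :
    |∫ x in D, inner ℝ (g x) (gradient v x)| ≤
      Real.sqrt Real.pi * h * (K₁ * l2norm D g) :=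
  abs_setIntegral_inner_le hg (continuous_gradient hv.contDiff) hh hv.nonneg₁ hv.norm_gradient_le
    fun _ => hv.gradient_eq_zero

end IsLocalTest

namespace IsResidualSetting

variable {v : Plane → ℝ} {c : Plane} {h K₀ K₁ : ℝ}

theorem memLp_error (H : IsResidualSetting 𝒯 k σ M a f aT fT p gu guh) (hT : T ∈ 𝒯.cells) :
    MemLp (fun x => gu x - guh x) 2 (volume.restrict (cell T)) :=
  𝒯.memLp_cell hT (H.memLp_gu.sub H.memLp_guh)

theorem memLp_evalAt (q : MvPolynomial (Fin 2) ℝ) (T : Triangle) :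
    MemLp (evalAt q) 2 (volume.restrict (cell T)) := by
  have : IsFiniteMeasure ((volume : Measure Plane).restrict (cell T)) :=
    ⟨by simpa using (isCompact_cell T).measure_lt_top⟩
  obtain ⟨K, hK⟩ := (isCompact_cell T).exists_bound_of_continuousOn
    (continuous_evalAt q).continuousOn
  exact MemLp.of_bound (continuous_evalAt q).aestronglyMeasurable K
    ((ae_restrict_iff' (measurableSet_cell T)).2 (Eventually.of_forall hK))

theorem memLp_osc (H : IsResidualSetting 𝒯 k σ M a f aT fT p gu guh) (hT : T ∈ 𝒯.cells) :
    MemLp (fun x => f x - evalAt (fT T) x) 2 (volume.restrict (cell T)) :=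
  (𝒯.memLp_cell hT H.memLp_f).sub (memLp_evalAt _ T)

theorem integrableOn_form (H : IsResidualSetting 𝒯 k σ M a f aT fT p gu guh) (hT : T ∈ 𝒯.cells)
    (hv : IsLocalTest v c h K₀ K₁) :
    IntegrableOn (fun x => a x * inner ℝ (gu x) (gradient v x)) (cell T) :=
  ((hv.integrable_inner (𝒯.memLp_cell hT H.memLp_gu)).const_mul (aT T)).congr
    ((H.a_eq T hT).mono fun x hx => by simp only [hx])

/-- The local residual equation, up to the data oscillation and the error. -/
theorem abs_residual_le (H : IsResidualSetting 𝒯 k σ M a f aT fT p gu guh) (hT : T ∈ 𝒯.cells)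
    (hv : IsLocalTest v c h K₀ K₁) (hh : 0 ≤ h) :
    |(∫ x in cell T, a x * inner ℝ (gu x) (gradient v x)) - (∫ x in cell T, f x * v x) +
        (∫ x in cell T, evalAt (residual (aT T) (fT T) (p T)) x * v x) -
        aT T * ∫ x in cell T, (inner ℝ (gradAt (p T) x) (gradient v x) + laplAt (p T) x * v x)| ≤
      Real.sqrt Real.pi * h * (M * (K₁ * l2norm (cell T) (fun x => gu x - guh x)) +
        K₀ * l2norm (cell T) (fun x => f x - evalAt (fT T) x)) := by
  have i1 := hv.integrable_inner (𝒯.memLp_cell hT H.memLp_gu)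
  have i2 := hv.integrable_mul (𝒯.memLp_cell hT H.memLp_f)
  have i3 := hv.integrable_continuous_mul (volume.restrict (cell T))
    (continuous_evalAt (residual (aT T) (fT T) (p T)))
  have i4 := hv.integrable_green (volume.restrict (cell T)) (p T)
  have i5 := hv.integrable_inner (H.memLp_error hT)
  have i6 := hv.integrable_mul (H.memLp_osc hT)
  have i12 : Integrable (fun x => aT T * inner ℝ (gu x) (gradient v x) - f x * v x)
      (volume.restrict (cell T)) := (i1.const_mul _).sub i2
  have i123 : Integrable (fun x => aT T * inner ℝ (gu x) (gradient v x) - f x * v x +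
      evalAt (residual (aT T) (fT T) (p T)) x * v x) (volume.restrict (cell T)) := i12.add i3
  have e1 : ∫ x in cell T, a x * inner ℝ (gu x) (gradient v x) =
      ∫ x in cell T, aT T * inner ℝ (gu x) (gradient v x) :=
    integral_congr_ae ((H.a_eq T hT).mono fun x hx => by simp only [hx])
  -- On the cell, `a` is constant and `guh` is the gradient of `p T`; the Laplacian terms from the
  -- residual and from the Green integrand cancel.
  have e2 : (∫ x in cell T, a x * inner ℝ (gu x) (gradient v x)) - (∫ x in cell T, f x * v x) +
        (∫ x in cell T, evalAt (residual (aT T) (fT T) (p T)) x * v x) -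
        aT T * ∫ x in cell T, (inner ℝ (gradAt (p T) x) (gradient v x) + laplAt (p T) x * v x) =
      aT T * (∫ x in cell T, inner ℝ (gu x - guh x) (gradient v x)) -
        ∫ x in cell T, (f x - evalAt (fT T) x) * v x := by
    rw [e1, ← integral_sub (i1.const_mul _) i2, ← integral_add i12 i3,
      ← integral_const_mul, ← integral_sub i123 (i4.const_mul _),
      ← integral_const_mul, ← integral_sub (i5.const_mul _) i6]
    refine integral_congr_ae ((H.guh_eq T hT).mono fun x hx => ?_)
    simp only [hx, evalAt_residual, inner_sub_left]
    ring
  rw [e2]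
  have b1 := hv.abs_setIntegral_inner_gradient_le hh (H.memLp_error hT)
  have b2 := hv.abs_setIntegral_mul_le hh (H.memLp_osc hT)
  refine (abs_sub _ _).trans ?_
  rw [abs_mul]
  have b3 := mul_le_mul (H.abs_le T hT) b1 (abs_nonneg _)
    ((abs_nonneg _).trans (H.abs_le T hT))
  calc _ ≤ M * (Real.sqrt Real.pi * h * (K₁ * l2norm (cell T) fun x => gu x - guh x)) +
        Real.sqrt Real.pi * h * (K₀ * l2norm (cell T) fun x => f x - evalAt (fT T) x) :=
        add_le_add b3 b2
    _ = _ := by ring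

end IsResidualSetting

/-! ### The element residual -/

/-- The integrand is cut-off times w², hence nonnegative, and only the ball where the cut-off equals
1 is kept; h² is the area scaling. -/
theorem setIntegral_bubble_ge {b : Plane → ℝ} {δ D : ℝ} (hb : IsCutoff b δ D) {c : Plane} {h : ℝ}
    (hh : 0 < h) {S : Set Plane} (hS : Metric.closedBall c (h * δ) ⊆ S)
    {w : Plane → ℝ} (hint : IntegrableOn (fun x => w x * bubble b c h w x) S) :
    h ^ 2 * ∫ y in Metric.closedBall (0 : Plane) δ, w (c + h • y) ^ 2 ≤
      ∫ x in S, w x * bubble b c h w x := by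
  have hpos : ∀ x, 0 ≤ w x * bubble b c h w x := fun x => by
    have := hb.nonneg (h⁻¹ • (x - c))
    rw [bubble, show w x * (b (h⁻¹ • (x - c)) * w x) = b (h⁻¹ • (x - c)) * w x ^ 2 by ring]
    positivity
  rw [← setIntegral_closedBall_comp c hh δ fun x => w x ^ 2]
  calc _ = ∫ x in Metric.closedBall c (h * δ), w x * bubble b c h w x := by
        refine setIntegral_congr_fun Metric.isClosed_closedBall.measurableSet fun x hx => ?_
        rw [Metric.mem_closedBall, dist_eq_norm] at hx
        simp only [bubble]
        rw [hb.eq_one, one_mul, sq]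
        rw [norm_smul, norm_inv, Real.norm_of_nonneg hh.le, inv_mul_eq_div, div_le_iff₀ hh]
        linarith
    _ ≤ _ := setIntegral_mono_set hint (Eventually.of_forall hpos) hS.eventuallyLE

theorem l2norm_cell_le {g : Plane → ℝ} (hg : Continuous g) (T : Triangle) {K : ℝ} (hK : 0 ≤ K)
    (h : ∀ x ∈ cell T, |g x| ≤ K) : l2norm (cell T) g ≤ Real.sqrt Real.pi * (2 * hT T) * K := by
  have hh := hT_pos T
  refine Real.sqrt_le_iff.2 ⟨by positivity, ?_⟩
  have hsub : cell T ⊆ Metric.ball (T.points 0) (2 * hT T) := fun x hx => by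
    have := dist_le_hT hx (points_mem_cell T 0)
    rw [Metric.mem_ball]; linarith
  calc ∫ x in cell T, ‖g x‖ ^ 2 ≤ ∫ x in cell T, K ^ 2 := by
        refine setIntegral_mono_on ((hg.norm.pow 2).continuousOn.integrableOn_compact
          (isCompact_cell T)) (integrableOn_const (isCompact_cell T).measure_lt_top.ne)
          (measurableSet_cell T) fun x hx => ?_
        rw [Real.norm_eq_abs]
        exact pow_le_pow_left₀ (abs_nonneg _) (h x hx) 2
    _ = volume.real (cell T) * K ^ 2 := by rw [setIntegral_const, smul_eq_mul]
    _ ≤ volume.real (Metric.ball (T.points 0) (2 * hT T)) * K ^ 2 := by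
        gcongr
        exact measure_ball_lt_top.ne
    _ = (Real.sqrt Real.pi * (2 * hT T) * K) ^ 2 := by
        rw [volume_real_ball_plane _ (by positivity), mul_pow _ K,
          mul_pow (Real.sqrt _), Real.sq_sqrt Real.pi_pos.le]

/-- The estimate of the element residual. -/
theorem exists_element_residual_le (k : ℕ) {σ : ℝ} (hσ : 0 < σ) {M : ℝ} (hM : 0 ≤ M) :
    ∃ C, 0 < C ∧ ∀ (Ω : Set Plane) (𝒯 : Triangulation Ω) (a f : Plane → ℝ) (aT : Triangle → ℝ)
      (fT p : Triangle → MvPolynomial (Fin 2) ℝ) (gu guh : Plane → Plane),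
      IsResidualSetting 𝒯 k σ M a f aT fT p gu guh → ∀ T ∈ 𝒯.cells,
      hT T * l2norm (cell T) (evalAt (residual (aT T) (fT T) (p T))) ≤
        C * (l2norm (cell T) (fun x => gu x - guh x) +
          hT T * l2norm (cell T) (fun x => f x - evalAt (fT T) x)) := by
  -- The radius 4δh_T must not exceed h_T/(4σ), so that the support stays in the inscribed ball, nor
  -- h_T, where the polynomial bounds hold.
  set δ := min (1 / (16 * σ)) (1 / 4) with hδdef
  have hδ : 0 < δ := lt_min (by positivity) (by norm_num)
  have hδ1 : 4 * δ ≤ 1 := by linarith [min_le_right (1 / (16 * σ)) (1 / 4 : ℝ)]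
  have hδ2 : 4 * δ ≤ 1 / (4 * σ) := by
    have := min_le_left (1 / (16 * σ)) (1 / 4 : ℝ)
    have e : 1 / (4 * σ) = 4 * (1 / (16 * σ)) := by field_simp; norm_num
    rw [e]; linarith
  obtain ⟨b, D, hb⟩ := exists_isCutoff hδ
  obtain ⟨C₀, hC₀, hpoly⟩ := exists_evalAt_sq_le k hδ
  have hD := hb.bound_nonneg
  refine ⟨Real.pi * 2 * C₀ * (M * (D + 1) + 1), by positivity, ?_⟩
  intro Ω 𝒯 a f aT fT p gu guh H T hTc
  set r := residual (aT T) (fT T) (p T) with hr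
  set h := hT T with hhdef
  have hh : 0 < h := hT_pos T
  obtain ⟨c, hc⟩ := exists_ball_subset_cell (H.regular T hTc)
  rw [← hhdef] at hc
  have hball : Metric.ball c (h * (4 * δ)) ⊆ cell T := (Metric.ball_subset_ball (by
    rw [div_eq_mul_one_div]; exact mul_le_mul_of_nonneg_left hδ2 hh.le)).trans hc
  have hcT : c ∈ cell T := hball (Metric.mem_ball_self (by positivity))
  obtain ⟨q, hqdeg, hq⟩ := exists_evalAt_comp r c h
  replace hqdeg : q.totalDegree ≤ k := hqdeg.trans
    (totalDegree_residual_le (H.degree_f T hTc) (H.degree_p T hTc))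
  have hqgrad : ∀ y, gradAt q y = h • gradAt r (c + h • y) := fun y => by
    rw [← gradient_evalAt, show evalAt q = fun y => evalAt r (c + h • y) from funext hq,
      gradient_comp_affine (contDiff_evalAt r), gradient_evalAt]
  set I := ∫ y in Metric.closedBall (0 : Plane) δ, evalAt q y ^ 2 with hI
  have hI0 : 0 ≤ I := by positivity
  -- After rescaling to the unit ball, K bounds |r| and h·|∇r| on the ball of radius h around c,
  -- which contains the whole cell.
  set K := Real.sqrt (C₀ * I) with hK
  have hscale : ∀ x : Plane, ‖x - c‖ ≤ h → ‖h⁻¹ • (x - c)‖ ≤ 1 ∧ c + h • h⁻¹ • (x - c) = x := by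
    intro x hx
    constructor
    · rw [norm_smul, norm_inv, Real.norm_of_nonneg hh.le, inv_mul_eq_div, div_le_one hh]
      exact hx
    · rw [smul_inv_smul₀ hh.ne']; abel
  have hrK : ∀ x, ‖x - c‖ ≤ h → |evalAt r x| ≤ K := by
    intro x hx
    obtain ⟨h1, h2⟩ := hscale x hx
    have h3 := (hpoly q hqdeg _ h1).1
    rw [hq, h2] at h3
    exact Real.abs_le_sqrt h3
  have hrK' : ∀ x, ‖x - c‖ ≤ h → ‖gradient (evalAt r) x‖ ≤ h⁻¹ * K := by
    intro x hx
    obtain ⟨h1, h2⟩ := hscale x hx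
    have h3 := (hpoly q hqdeg _ h1).2
    rw [hqgrad, h2] at h3
    have h4 := Real.le_sqrt_of_sq_le h3
    rw [norm_smul, Real.norm_of_nonneg hh.le] at h4
    rw [gradient_evalAt, inv_mul_eq_div, le_div_iff₀ hh]
    linarith
  have hv := hb.isLocalTest_bubble hδ hδ1 hh (contDiff_evalAt r) hrK hrK'
  set v := bubble b c h (evalAt r) with hvdef
  have hvint : Metric.ball c (h * (4 * δ)) ⊆ interior (cell T) :=
    interior_maximal hball Metric.isOpen_ball
  have hvΩ : Metric.ball c (h * (4 * δ)) ⊆ Ω := hvint.trans (𝒯.interior_subset T hTc)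
  have hvtest := hv.isTestFunction hvΩ
  have hKnn := hv.nonneg₀
  have hB : (∫ x in cell T, a x * inner ℝ (gu x) (gradient v x)) =
      ∫ x in cell T, f x * v x := by
    have := H.weak v hvtest
    rw [setIntegral_congr_of_forall_mem_iff (B := Metric.ball c (h * (4 * δ)))
        H.isOpen.measurableSet (measurableSet_cell T)
        (fun x hx => by rw [hv.gradient_eq_zero hx, inner_zero_right, mul_zero])
        (fun x hx => iff_of_true (hvΩ hx) (hball hx)),
      setIntegral_congr_of_forall_mem_iff (B := Metric.ball c (h * (4 * δ)))
        H.isOpen.measurableSet (measurableSet_cell T)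
        (fun x hx => by rw [hv.eq_zero hx, mul_zero])
        (fun x hx => iff_of_true (hvΩ hx) (hball hx))] at this
    exact this
  have hG : ∫ x in cell T, (inner ℝ (gradAt (p T) x) (gradient v x) + laplAt (p T) x * v x) = 0 := by
    rw [setIntegral_eq_integral_of_forall_compl_eq_zero fun x hx => by
      rw [hv.gradient_eq_zero fun h' => hx (hball h'), hv.eq_zero fun h' => hx (hball h'),
        inner_zero_right, mul_zero, add_zero]]
    exact integral_inner_gradAt_add_laplAt_mul hv.contDiff hv.hasCompactSupport _
  have hmain := H.abs_residual_le hTc hv (by positivity)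
  rw [hB, hG, sub_self, zero_add, mul_zero, sub_zero, ← hr] at hmain
  have hlow := setIntegral_bubble_ge hb hh (S := cell T) (w := evalAt r)
    ((Metric.closedBall_subset_ball (by nlinarith)).trans hball)
    (hv.integrable_continuous_mul _ (continuous_evalAt r))
  simp_rw [← hq] at hlow
  rw [← hI] at hlow
  set E := l2norm (cell T) (fun x => gu x - guh x)
  set O := l2norm (cell T) (fun x => f x - evalAt (fT T) x)
  have hE : 0 ≤ E := l2norm_nonneg _ _
  have hO : 0 ≤ O := l2norm_nonneg _ _
  have hup : h ^ 2 * I ≤ Real.sqrt Real.pi * ((M * (D + 1) + 1) * (E + h * O)) * K := by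
    refine (hlow.trans (le_abs_self _)).trans (hmain.trans ?_)
    have e1 : Real.sqrt Real.pi * (h * (4 * δ)) * (M * (h⁻¹ * ((D + 1) * K) * E) + K * O) =
        Real.sqrt Real.pi * ((4 * δ) * (M * (D + 1) * E + h * O)) * K := by
      field_simp
    rw [e1]
    have e2 : M * (D + 1) * E + h * O ≤ (M * (D + 1) + 1) * (E + h * O) := by
      have : 0 ≤ M * (D + 1) * (h * O) := by positivity
      nlinarith
    have e3 : 4 * δ * (M * (D + 1) * E + h * O) ≤ 1 * (M * (D + 1) * E + h * O) := by
      gcongr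
    exact mul_le_mul_of_nonneg_right
      (mul_le_mul_of_nonneg_left (by linarith) (Real.sqrt_nonneg _)) hKnn
  have hKsq : K ^ 2 = C₀ * I := Real.sq_sqrt (by positivity)
  -- The lower bound is quadratic in K and the upper bound linear, so one factor K cancels; K = 0 is
  -- trivial.
  have hKup : h ^ 2 * K ≤ C₀ * (Real.sqrt Real.pi * ((M * (D + 1) + 1) * (E + h * O))) := by
    rcases hKnn.eq_or_lt with h0 | h0
    · rw [← h0, mul_zero]; positivity
    · refine le_of_mul_le_mul_right ?_ h0
      calc h ^ 2 * K * K = C₀ * (h ^ 2 * I) := by linear_combination h ^ 2 * hKsq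
        _ ≤ C₀ * (Real.sqrt Real.pi * ((M * (D + 1) + 1) * (E + h * O)) * K) := by gcongr
        _ = _ := by ring
  have hnorm := l2norm_cell_le (continuous_evalAt r) T hKnn fun x hx =>
    hrK x (by rw [← dist_eq_norm]; exact dist_le_hT hx hcT)
  calc h * l2norm (cell T) (evalAt r) ≤ h * (Real.sqrt Real.pi * (2 * h) * K) := by gcongr
    _ = Real.sqrt Real.pi * 2 * (h ^ 2 * K) := by ring
    _ ≤ Real.sqrt Real.pi * 2 *
        (C₀ * (Real.sqrt Real.pi * ((M * (D + 1) + 1) * (E + h * O)))) := by gcongr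
    _ = (Real.sqrt Real.pi * Real.sqrt Real.pi) * 2 * C₀ * (M * (D + 1) + 1) * (E + h * O) := by
        ring
    _ = _ := by rw [Real.mul_self_sqrt Real.pi_pos.le]

/-! ### The jump residual -/

variable {Ω : Set Plane} {𝒯 : Triangulation Ω} {k : ℕ} {σ M : ℝ} {a f : Plane → ℝ}
  {aT : Triangle → ℝ} {fT p : Triangle → MvPolynomial (Fin 2) ℝ} {gu guh : Plane → Plane}

/-- The function is constant in directions orthogonal to τ, so its gradient involves only the
one-variable derivative. -/
theorem gradient_eval_inner (J : Polynomial ℝ) (m τ : Plane) (c : ℝ) (x : Plane) :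
    gradient (fun x => J.eval (c * inner ℝ (x - m) τ)) x =
      (c * J.derivative.eval (c * inner ℝ (x - m) τ)) • τ := by
  have h1 : HasFDerivAt (fun x : Plane => c * inner ℝ (x - m) τ) (c • innerSL ℝ τ) x := by
    have h2 : (fun x : Plane => c * inner ℝ (x - m) τ) =
        fun x => (c • innerSL ℝ τ) x - c * inner ℝ m τ := by
      funext x
      simp [inner_sub_right, real_inner_comm τ, mul_sub]
    rw [h2]
    exact (c • innerSL ℝ τ).hasFDerivAt.sub_const _
  have h3 := (J.hasDerivAt (c * inner ℝ (x - m) τ)).comp_hasFDerivAt x h1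
  have h4 : HasGradientAt (fun x => J.eval (c * inner ℝ (x - m) τ))
      ((c * J.derivative.eval (c * inner ℝ (x - m) τ)) • τ) x := by
    rw [hasGradientAt_iff_hasFDerivAt]
    convert! h3 using 1
    ext y
    simp
    ring
  exact h4.gradient

/-- The normal component of the jump of the flux, as a polynomial. -/
theorem exists_evalAt_eq_jump (α α' : ℝ) (q q' : MvPolynomial (Fin 2) ℝ) (n : Plane) {k : ℕ}
    (hq : q.totalDegree ≤ k) (hq' : q'.totalDegree ≤ k) :
    ∃ W : MvPolynomial (Fin 2) ℝ, W.totalDegree ≤ k ∧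
      ∀ x, evalAt W x = inner ℝ (α • gradAt q x - α' • gradAt q' x) n := by
  have hC : ∀ (c : ℝ) (s : MvPolynomial (Fin 2) ℝ), s.totalDegree ≤ k →
      (MvPolynomial.C c * s).totalDegree ≤ k := fun c s hs =>
    (MvPolynomial.totalDegree_mul _ _).trans (by rwa [MvPolynomial.totalDegree_C, zero_add])
  have hd : ∀ i, (MvPolynomial.C (n i) * (MvPolynomial.C α * MvPolynomial.pderiv i q -
      MvPolynomial.C α' * MvPolynomial.pderiv i q')).totalDegree ≤ k := fun i =>
    hC _ _ ((MvPolynomial.totalDegree_sub _ _).trans (max_le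
      (hC _ _ ((totalDegree_pderiv_le i q).trans hq))
      (hC _ _ ((totalDegree_pderiv_le i q').trans hq'))))
  refine ⟨_, (MvPolynomial.totalDegree_add _ _).trans (max_le (hd 0) (hd 1)), fun x => ?_⟩
  simp [evalAt, inner_plane, gradAt]
  ring

theorem lineMap_eq_midpoint_add (P Q : Plane) (t : ℝ) :
    AffineMap.lineMap P Q t = midpoint ℝ P Q + (t - 1 / 2) • (Q - P) := by
  ext i
  simp [AffineMap.lineMap_apply, midpoint_eq_smul_add]
  ring

theorem IsCutoff.le_integral_line {b : Plane → ℝ} {δ D : ℝ} (hb : IsCutoff b δ D)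
    (J : Polynomial ℝ) {τ : Plane} (hτ : ‖τ‖ = 1) :
    ∫ t in Set.Icc (-δ) δ, J.eval t ^ 2 ≤ ∫ t : ℝ, b (t • τ) * J.eval t ^ 2 := by
  have hnorm : ∀ t : ℝ, ‖t • τ‖ = |t| := fun t => by
    rw [norm_smul, hτ, mul_one, Real.norm_eq_abs]
  have hbc := hb.contDiff.continuous
  have hJc := J.continuous
  have hint : Integrable fun t : ℝ => b (t • τ) * J.eval t ^ 2 := by
    refine Continuous.integrable_of_hasCompactSupport (by fun_prop)
      (HasCompactSupport.intro (isCompact_Icc (a := -(2 * δ)) (b := 2 * δ)) fun t ht => ?_)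
    rw [hb.eq_zero, zero_mul]
    rw [hnorm]
    by_contra! h
    exact ht (abs_le.1 h.le)
  calc _ = ∫ t in Set.Icc (-δ) δ, b (t • τ) * J.eval t ^ 2 := by
        refine setIntegral_congr_fun measurableSet_Icc fun t ht => ?_
        rw [hb.eq_one _ (by rw [hnorm]; exact abs_le.2 ht), one_mul]
    _ ≤ _ := setIntegral_le_integral hint
        (Eventually.of_forall fun t => mul_nonneg (hb.nonneg _) (sq_nonneg _))

/-- The quantities that bound the jump residuals. -/
noncomputable def localBound (aT : Triangle → ℝ) (f : Plane → ℝ)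
    (fT p : Triangle → MvPolynomial (Fin 2) ℝ) (gu guh : Plane → Plane) (T : Triangle) : ℝ :=
  l2norm (cell T) (fun x => gu x - guh x) +
    hT T * l2norm (cell T) (fun x => f x - evalAt (fT T) x) +
    hT T * l2norm (cell T) (evalAt (residual (aT T) (fT T) (p T)))

/-- A normal pointing into `T` is needed for Green's formula. It may differ from `unitNormal` by a
sign, which disappears when the jump is squared. -/
theorem exists_isSide_neg (𝒯 : Triangulation Ω) (hσ : 𝒯.IsRegular σ) {T T' : Triangle}
    (hT : T ∈ 𝒯.cells) (hT' : T' ∈ 𝒯.cells) {i : Fin 3} (hnb : IsNeighbour T i T') :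
    ∃ n : Plane, (n = unitNormal (edgeFst T i) (edgeSnd T i) ∨
        n = -unitNormal (edgeFst T i) (edgeSnd T i)) ∧
      IsSide T (edgeFst T i) (edgeSnd T i) n ∧ IsSide T' (edgeFst T i) (edgeSnd T i) (-n) := by
  have hPQ := edgeFst_ne_edgeSnd T i
  have hn := norm_unitNormal hPQ
  have hin := inner_sub_unitNormal (edgeFst T i) (edgeSnd T i)
  set n₀ := unitNormal (edgeFst T i) (edgeSnd T i)
  have hP : edgeFst T i ∈ Set.range T.points := ⟨_, rfl⟩
  have hQ : edgeSnd T i ∈ Set.range T.points := ⟨_, rfl⟩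
  have ρ := rhoT_pos (hσ T hT)
  have ρ' := rhoT_pos (hσ T' hT')
  have hn' : ‖-n₀‖ = 1 := by rw [norm_neg, hn]
  have hin' : inner ℝ (edgeSnd T i - edgeFst T i) (-n₀) = 0 := by
    rw [inner_neg_right, hin, neg_zero]
  have key : ∀ n, ‖n‖ = 1 → inner ℝ (edgeSnd T i - edgeFst T i) n = 0 →
      IsSide T (edgeFst T i) (edgeSnd T i) n → IsSide T' (edgeFst T i) (edgeSnd T i) (-n) := by
    intro n hn hin s
    refine (exists_isSide hnb.2.1 hnb.2.2 hPQ ρ' hn hin).resolve_left ?_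
    exact 𝒯.isSide_ne hT hT' hnb.1.symm hn hin hPQ hP hQ hnb.2.1 hnb.2.2 ρ ρ' s
  rcases exists_isSide hP hQ hPQ ρ hn hin with s | s
  · exact ⟨n₀, Or.inl rfl, s, key _ hn hin s⟩
  · exact ⟨-n₀, Or.inr rfl, s, key _ hn' hin' s⟩

/-- Testing with a bubble around the midpoint of the edge produces the jump as boundary term. It is
bounded by errors, oscillations and element residuals of the two triangles; the last are kept in
`localBound` and absorbed later. -/
theorem exists_jump_le (k : ℕ) {σ : ℝ} (hσ : 0 < σ) {M : ℝ} (hM : 0 ≤ M) :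
    ∃ C, 0 < C ∧ ∀ (Ω : Set Plane) (𝒯 : Triangulation Ω) (a f : Plane → ℝ) (aT : Triangle → ℝ)
      (fT p : Triangle → MvPolynomial (Fin 2) ℝ) (gu guh : Plane → Plane),
      IsResidualSetting 𝒯 k σ M a f aT fT p gu guh → ∀ T ∈ 𝒯.cells, ∀ T' ∈ 𝒯.cells,
      ∀ i, IsInteriorEdge Ω T i → IsNeighbour T i T' →
      Real.sqrt (dist (edgeFst T i) (edgeSnd T i)) *
        l2edge (edgeFst T i) (edgeSnd T i) (fun x =>
          inner ℝ (aT T • gradAt (p T) x - aT T' • gradAt (p T') x)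
            (unitNormal (edgeFst T i) (edgeSnd T i))) ≤
        C * (localBound aT f fT p gu guh T + localBound aT f fT p gu guh T') := by
  -- Since the edge length is at most h_S ≤ σρ_S for each adjacent triangle S, the radius 4δh is at
  -- most ρ_S/4, within the range ρ_S/2 of `IsSide`.
  set δ := min (1 / (16 * σ)) (1 / 4) with hδdef
  have hδ : 0 < δ := lt_min (by positivity) (by norm_num)
  have hδ1 : 4 * δ ≤ 1 := by linarith [min_le_right (1 / (16 * σ)) (1 / 4 : ℝ)]
  have hδ2 : 4 * δ * σ ≤ 1 / 4 := by
    have := min_le_left (1 / (16 * σ)) (1 / 4 : ℝ)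
    rw [← hδdef, le_div_iff₀ (by positivity)] at this
    linarith
  obtain ⟨b, D, hb⟩ := exists_isCutoff hδ
  obtain ⟨C₀, hC₀, hpoly⟩ := exists_eval_sq_le k hδ
  have hD := hb.bound_nonneg
  refine ⟨C₀ * (Real.sqrt Real.pi * (M * (D + 1) + 1)), by positivity, ?_⟩
  intro Ω 𝒯 a f aT fT p gu guh H T hTc T' hTc' i hint hnb
  obtain ⟨n, hn₀, hs, hs'⟩ := exists_isSide_neg 𝒯 H.regular hTc hTc' hnb
  have hPQ := edgeFst_ne_edgeSnd T i
  have hPT : edgeFst T i ∈ cell T := points_mem_cell T _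
  have hQT : edgeSnd T i ∈ cell T := points_mem_cell T _
  have hPT' : edgeFst T i ∈ cell T' := subset_convexHull ℝ _ hnb.2.1
  have hQT' : edgeSnd T i ∈ cell T' := subset_convexHull ℝ _ hnb.2.2
  have hun := norm_unitNormal hPQ
  have hin := inner_sub_unitNormal (edgeFst T i) (edgeSnd T i)
  rw [IsInteriorEdge] at hint
  set P := edgeFst T i
  set Q := edgeSnd T i
  set h := dist P Q with hhdef
  have hh : 0 < h := dist_pos.2 hPQ
  have hhQP : ‖Q - P‖ = h := by rw [hhdef, dist_comm, dist_eq_norm]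
  have hhT : h ≤ hT T := dist_le_hT hPT hQT
  have hhT' : h ≤ hT T' := dist_le_hT hPT' hQT'
  have hn : ‖n‖ = 1 := by rcases hn₀ with rfl | rfl <;> simp [hun]
  set τ := h⁻¹ • (Q - P) with hτdef
  have hτ : ‖τ‖ = 1 := by
    rw [hτdef, norm_smul, hhQP, norm_inv, Real.norm_of_nonneg hh.le, inv_mul_cancel₀ hh.ne']
  have hhτ : h • τ = Q - P := smul_inv_smul₀ hh.ne' _
  have hτn : inner ℝ τ n = 0 := by
    rw [hτdef, inner_smul_left]
    rcases hn₀ with rfl | rfl <;> simp [hin]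
  set m := midpoint ℝ P Q with hm
  set B := Metric.ball m (h * (4 * δ)) with hBdef
  have hBρ : ∀ S ∈ 𝒯.cells, h ≤ hT S → ∀ x ∈ B, ‖x - m‖ < rhoT S / 2 := by
    intro S hS hle x hx
    have h1 := H.regular S hS
    have h2 := rhoT_pos h1
    rw [hBdef, Metric.mem_ball, dist_eq_norm] at hx
    have h3 : h * (4 * δ) ≤ σ * rhoT S * (4 * δ) :=
      mul_le_mul_of_nonneg_right (hle.trans h1) (by positivity)
    have h4 : (4 * δ * σ) * rhoT S ≤ 1 / 4 * rhoT S := mul_le_mul_of_nonneg_right hδ2 h2.le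
    linarith
  have hBT : ∀ x ∈ B, x ∈ cell T ↔ 0 ≤ inner ℝ (x - m) n := fun x hx =>
    ⟨hs.subset x, hs.mem_cell x (hBρ T hTc hhT x hx)⟩
  have hBT' : ∀ x ∈ B, x ∈ cell T' ↔ 0 ≤ inner ℝ (x - m) (-n) := fun x hx =>
    ⟨hs'.subset x, hs'.mem_cell x (hBρ T' hTc' hhT' x hx)⟩
  -- Off the edge line, points of the ball are interior to one of the two cells; on the line they
  -- lie in the open edge, which is in Ω because the edge is interior.
  have hBΩ : B ⊆ Ω := by
    intro x hx
    rcases lt_trichotomy (inner ℝ (x - m) n) 0 with h0 | h0 | h0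
    · exact 𝒯.interior_subset T' hTc' (hs'.mem_interior x (hBρ T' hTc' hhT' x hx)
        (by rw [inner_neg_right]; linarith))
    · exact hint (hs.mem_openSegment x (hBρ T hTc hhT x hx) h0)
    · exact 𝒯.interior_subset T hTc (hs.mem_interior x (hBρ T hTc hhT x hx) h0)
  have hdisj : AEDisjoint volume (cell T) (cell T') := by
    refine measure_mono_null (fun x hx => ?_) (volume_line_eq_zero m τ n hτ hn hτn)
    have h1 := hs.subset x hx.1
    have h2 := hs'.subset x hx.2
    rw [inner_neg_right] at h2
    exact le_antisymm (by linarith) h1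
  have hsplit : ∀ F : Plane → ℝ, (∀ x, x ∉ B → F x = 0) → IntegrableOn F (cell T) →
      IntegrableOn F (cell T') →
      ∫ x in Ω, F x = (∫ x in cell T, F x) + ∫ x in cell T', F x := by
    intro F hF i1 i2
    rw [← setIntegral_union₀ hdisj (measurableSet_cell T').nullMeasurableSet i1 i2]
    refine setIntegral_congr_of_forall_mem_iff H.isOpen.measurableSet
      ((measurableSet_cell T).union (measurableSet_cell T')) hF fun x hx =>
      iff_of_true (hBΩ hx) ?_
    rcases le_total 0 (inner ℝ (x - m) n) with h0 | h0
    · exact Or.inl ((hBT x hx).2 h0)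
    · exact Or.inr ((hBT' x hx).2 (by rw [inner_neg_right]; linarith))
  obtain ⟨W, hWdeg, hW⟩ := exists_evalAt_eq_jump (aT T) (aT T') (p T) (p T') n
    (H.degree_p T hTc) (H.degree_p T' hTc')
  -- Parameter 0 is the midpoint and ±1/2 are the endpoints, so [-1, 1] covers the edge.
  obtain ⟨J, hJdeg, hJ⟩ := exists_eval_line W m (Q - P)
  replace hJdeg := hJdeg.trans hWdeg
  set I := ∫ t in Set.Icc (-δ) δ, J.eval t ^ 2 with hI
  have hI0 : 0 ≤ I := by positivity
  set K := Real.sqrt (C₀ * I) with hK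
  have hKnn : 0 ≤ K := Real.sqrt_nonneg _
  have hKsq : K ^ 2 = C₀ * I := Real.sq_sqrt (by positivity)
  -- Extending the jump constantly in the normal direction makes values and gradient of `w` near the
  -- edge depend only on J and J' on [-1, 1].
  set w : Plane → ℝ := fun x => J.eval (h⁻¹ * inner ℝ (x - m) τ) with hw
  have hwc : ContDiff ℝ ∞ w :=
    (J.contDiff_aeval ∞).comp (contDiff_const.mul ((contDiff_id.sub contDiff_const).inner ℝ contDiff_const))
  have harg : ∀ x, ‖x - m‖ ≤ h → |h⁻¹ * inner ℝ (x - m) τ| ≤ 1 := by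
    intro x hx
    rw [abs_mul, abs_inv, abs_of_pos hh, inv_mul_eq_div, div_le_one hh]
    have := abs_real_inner_le_norm (x - m) τ
    rw [hτ, mul_one] at this
    exact this.trans hx
  have hv := hb.isLocalTest_bubble hδ hδ1 hh (c := m) (K := K) hwc
    (fun x hx => Real.abs_le_sqrt (hpoly J hJdeg _ (harg x hx)).1)
    (fun x hx => by
      rw [hw, gradient_eval_inner, norm_smul, hτ, mul_one, norm_mul, norm_inv,
        Real.norm_of_nonneg hh.le]
      exact mul_le_mul_of_nonneg_left (Real.abs_le_sqrt (hpoly J hJdeg _ (harg x hx)).2)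
        (inv_nonneg.2 hh.le))
  set v := bubble b m h w with hvdef
  have hvtest := hv.isTestFunction hBΩ
  have hrad : 0 ≤ h * (4 * δ) := by positivity
  have hline : ∀ g : Plane → ℝ, Continuous g →
      Integrable (fun s : ℝ => g (m + s • τ) * v (m + s • τ)) := by
    intro g hg
    have hvc := hv.contDiff.continuous
    refine Continuous.integrable_of_hasCompactSupport (by fun_prop) ?_
    exact (hv.hasCompactSupport.comp_isClosedEmbedding (isClosedEmbedding_line m hτ)).mul_left
  have hgn : ∀ q : MvPolynomial (Fin 2) ℝ, Continuous fun x => inner ℝ (gradAt q x) n := fun q =>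
    (continuous_gradAt q).inner continuous_const
  have hG : ∫ x in cell T, (inner ℝ (gradAt (p T) x) (gradient v x) + laplAt (p T) x * v x) =
      - ∫ s : ℝ, inner ℝ (gradAt (p T) (m + s • τ)) n * v (m + s • τ) := by
    rw [← setIntegral_halfPlane_inner_gradAt_add_laplAt_mul hv.contDiff hv.hasCompactSupport
      (p T) m τ n hτ hn hτn]
    refine setIntegral_congr_of_forall_mem_iff (measurableSet_cell T) ?_ (fun x hx => ?_) hBT
    · exact (isClosed_le continuous_const (by fun_prop)).measurableSet
    · rw [hv.gradient_eq_zero hx, hv.eq_zero hx, inner_zero_right, mul_zero, add_zero]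
  have hG' : ∫ x in cell T', (inner ℝ (gradAt (p T') x) (gradient v x) + laplAt (p T') x * v x) =
      ∫ s : ℝ, inner ℝ (gradAt (p T') (m + s • τ)) n * v (m + s • τ) := by
    have e := setIntegral_halfPlane_inner_gradAt_add_laplAt_mul hv.contDiff hv.hasCompactSupport
      (p T') m τ (-n) hτ (by rw [norm_neg, hn]) (by rw [inner_neg_right, hτn, neg_zero])
    simp_rw [inner_neg_right (gradAt _ _) n, neg_mul] at e
    rw [integral_neg, neg_neg] at e
    rw [← e]
    refine setIntegral_congr_of_forall_mem_iff (measurableSet_cell T') ?_ (fun x hx => ?_) hBT'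
    · exact (isClosed_le continuous_const (by fun_prop)).measurableSet
    · rw [hv.gradient_eq_zero hx, hv.eq_zero hx, inner_zero_right, mul_zero, add_zero]
  -- The inward normals of the two cells are opposite, so the two boundary terms combine to the jump
  -- of the flux.
  have hS : aT T * (∫ x in cell T, (inner ℝ (gradAt (p T) x) (gradient v x) +
        laplAt (p T) x * v x)) +
      aT T' * (∫ x in cell T', (inner ℝ (gradAt (p T') x) (gradient v x) +
        laplAt (p T') x * v x)) = - ∫ s : ℝ, evalAt W (m + s • τ) * v (m + s • τ) := by
    rw [hG, hG', mul_neg, ← integral_const_mul, ← integral_const_mul, neg_add_eq_sub, ← neg_sub,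
      ← integral_sub ((hline _ (hgn _)).const_mul _) ((hline _ (hgn _)).const_mul _)]
    congr 1
    refine integral_congr_ae (Eventually.of_forall fun s => ?_)
    simp only [hW, inner_sub_left, inner_smul_left]
    simp only [conj_trivial]
    ring
  -- Substituting s = ht gives the factor h; on the line the integrand becomes cut-off times J².
  have hlow : h * I ≤ ∫ s : ℝ, evalAt W (m + s • τ) * v (m + s • τ) := by
    have e1 := Measure.integral_comp_mul_left
      (fun s : ℝ => evalAt W (m + s • τ) * v (m + s • τ)) h
    have e2 : ∀ t : ℝ, evalAt W (m + (h * t) • τ) * v (m + (h * t) • τ) =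
        b (t • τ) * J.eval t ^ 2 := by
      intro t
      have e3 : (h * t) • τ = t • (Q - P) := by rw [mul_comm, mul_smul, hhτ]
      have e4 : h⁻¹ • (m + (h * t) • τ - m) = t • τ := by
        rw [add_sub_cancel_left, mul_smul, inv_smul_smul₀ hh.ne']
      have e5 : h⁻¹ * inner ℝ (m + (h * t) • τ - m) τ = t := by
        rw [add_sub_cancel_left, inner_smul_left, real_inner_self_eq_norm_sq, hτ]
        simp only [conj_trivial]
        field_simp
      rw [hvdef, bubble, e4, hw]
      simp only
      rw [e5, e3, ← hJ]
      ring
    simp_rw [e2] at e1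
    rw [abs_inv, abs_of_pos hh, smul_eq_mul] at e1
    have e6 := hb.le_integral_line J hτ
    rw [e1, ← hI, inv_mul_eq_div, le_div_iff₀ hh] at e6
    linarith
  have hA : ((∫ x in cell T, a x * inner ℝ (gu x) (gradient v x)) - ∫ x in cell T, f x * v x) +
      ((∫ x in cell T', a x * inner ℝ (gu x) (gradient v x)) - ∫ x in cell T', f x * v x) = 0 := by
    have e := H.weak v hvtest
    rw [hsplit (fun x => a x * inner ℝ (gu x) (gradient v x))
        (fun x hx => by rw [hv.gradient_eq_zero hx, inner_zero_right, mul_zero])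
        (H.integrableOn_form hTc hv) (H.integrableOn_form hTc' hv),
      hsplit (fun x => f x * v x) (fun x hx => by rw [hv.eq_zero hx, mul_zero])
        (hv.integrable_mul (𝒯.memLp_cell hTc H.memLp_f))
        (hv.integrable_mul (𝒯.memLp_cell hTc' H.memLp_f))] at e
    linarith
  have hbound : ∀ S ∈ 𝒯.cells, h ≤ hT S →
      Real.sqrt Real.pi * (h * (4 * δ)) * (M * (h⁻¹ * ((D + 1) * K) *
        l2norm (cell S) (fun x => gu x - guh x)) +
        K * l2norm (cell S) (fun x => f x - evalAt (fT S) x)) +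
      Real.sqrt Real.pi * (h * (4 * δ)) * (K *
        l2norm (cell S) (evalAt (residual (aT S) (fT S) (p S)))) ≤
      Real.sqrt Real.pi * (M * (D + 1) + 1) * localBound aT f fT p gu guh S * K := by
    intro S hS hle
    rw [localBound]
    set E := l2norm (cell S) (fun x => gu x - guh x)
    set O := l2norm (cell S) (fun x => f x - evalAt (fT S) x)
    set R := l2norm (cell S) (evalAt (residual (aT S) (fT S) (p S)))
    have hE : 0 ≤ E := l2norm_nonneg _ _
    have hO : 0 ≤ O := l2norm_nonneg _ _
    have hR : 0 ≤ R := l2norm_nonneg _ _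
    have e1 : Real.sqrt Real.pi * (h * (4 * δ)) * (M * (h⁻¹ * ((D + 1) * K) * E) + K * O) +
        Real.sqrt Real.pi * (h * (4 * δ)) * (K * R) =
        Real.sqrt Real.pi * ((4 * δ) * (M * (D + 1) * E + h * O + h * R)) * K := by
      field_simp
    have e2 : (4 * δ) * (M * (D + 1) * E + h * O + h * R) ≤
        1 * (M * (D + 1) * E + h * O + h * R) := by gcongr
    have e3 : M * (D + 1) * E + h * O + h * R ≤ M * (D + 1) * E + hT S * O + hT S * R := by gcongr
    have hpos := (hT_pos S).le
    have e4 : M * (D + 1) * E + hT S * O + hT S * R ≤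
        (M * (D + 1) + 1) * (E + hT S * O + hT S * R) := by
      have : 0 ≤ M * (D + 1) * (hT S * O + hT S * R) := by positivity
      linarith
    rw [e1, mul_assoc (Real.sqrt Real.pi) (M * (D + 1) + 1)]
    exact mul_le_mul_of_nonneg_right
      (mul_le_mul_of_nonneg_left (by linarith) (Real.sqrt_nonneg _)) hKnn
  set Z := localBound aT f fT p gu guh T + localBound aT f fT p gu guh T' with hZ
  have hZ0 : 0 ≤ Z := by
    have : ∀ S, 0 ≤ localBound aT f fT p gu guh S := fun S =>
      add_nonneg (add_nonneg (l2norm_nonneg _ _) (mul_nonneg (hT_pos S).le (l2norm_nonneg _ _)))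
        (mul_nonneg (hT_pos S).le (l2norm_nonneg _ _))
    exact add_nonneg (this T) (this T')
  -- The residual identities of both cells are added: the weak equation `hA` removes the terms in u
  -- and f, and `hS` supplies the jump.
  have hup : h * I ≤ Real.sqrt Real.pi * (M * (D + 1) + 1) * Z * K := by
    have b1 := H.abs_residual_le hTc hv hrad
    have b1' := H.abs_residual_le hTc' hv hrad
    have b2 := hv.abs_setIntegral_mul_le hrad
      (IsResidualSetting.memLp_evalAt (residual (aT T) (fT T) (p T)) T)
    have b2' := hv.abs_setIntegral_mul_le hrad
      (IsResidualSetting.memLp_evalAt (residual (aT T') (fT T') (p T')) T')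
    have b3 := hbound T hTc hhT
    have b3' := hbound T' hTc' hhT'
    have c1 := le_of_abs_le b1
    have c1' := le_of_abs_le b1'
    have c2 := neg_le_of_abs_le b2
    have c2' := neg_le_of_abs_le b2'
    have hZ' : Real.sqrt Real.pi * (M * (D + 1) + 1) * Z * K =
        Real.sqrt Real.pi * (M * (D + 1) + 1) * localBound aT f fT p gu guh T * K +
        Real.sqrt Real.pi * (M * (D + 1) + 1) * localBound aT f fT p gu guh T' * K := by
      rw [hZ]; ring
    rw [hZ']
    linarith
  have hKup : h * K ≤ C₀ * (Real.sqrt Real.pi * (M * (D + 1) + 1) * Z) := by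
    rcases hKnn.eq_or_lt with h0 | h0
    · rw [← h0, mul_zero]; positivity
    · refine le_of_mul_le_mul_right ?_ h0
      calc h * K * K = C₀ * (h * I) := by linear_combination h * hKsq
        _ ≤ C₀ * (Real.sqrt Real.pi * (M * (D + 1) + 1) * Z * K) := by gcongr
        _ = _ := by ring
  have hedge : l2edge P Q (fun x => inner ℝ (aT T • gradAt (p T) x - aT T' • gradAt (p T') x)
      (unitNormal P Q)) ≤ Real.sqrt h * K := by
    refine Real.sqrt_le_iff.2 ⟨by positivity, ?_⟩
    rw [mul_pow, Real.sq_sqrt hh.le]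
    refine mul_le_mul_of_nonneg_left ?_ hh.le
    have e1 : ∀ x, inner ℝ (aT T • gradAt (p T) x - aT T' • gradAt (p T') x)
        (unitNormal P Q) ^ 2 = evalAt W x ^ 2 := by
      intro x
      rw [hW]
      rcases hn₀ with rfl | rfl
      · rfl
      · rw [inner_neg_right, neg_sq]
    simp_rw [e1, lineMap_eq_midpoint_add, ← hm, ← hJ]
    have e2 := intervalIntegral.norm_integral_le_of_norm_le_const (a := (0 : ℝ)) (b := 1)
      (f := fun t => J.eval (t - 1 / 2) ^ 2) (C := K ^ 2) fun t ht => by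
        rw [Set.uIoc_of_le zero_le_one] at ht
        rw [Real.norm_of_nonneg (sq_nonneg _), hKsq]
        exact (hpoly J hJdeg _ (abs_le.2 ⟨by linarith [ht.1], by linarith [ht.2]⟩)).1
    have e3 := (le_abs_self _).trans e2
    simpa using e3
  calc Real.sqrt h * _ ≤ Real.sqrt h * (Real.sqrt h * K) := by gcongr
    _ = h * K := by rw [← mul_assoc, Real.mul_self_sqrt hh.le]
    _ ≤ _ := hKup
    _ = _ := by ring

/-! ### Patches -/

theorem Triangulation.cell_subset_patch (𝒯 : Triangulation Ω) {T S : Triangle}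
    (hS : S ∈ 𝒯.cells) (hST : (cell S ∩ cell T).Nonempty) : cell S ⊆ 𝒯.patch T := fun x hx => by
  simp only [Triangulation.patch, Set.mem_iUnion]
  exact ⟨S, hS, hST, hx⟩

theorem IsResidualSetting.l2norm_cell_le_patch
    (H : IsResidualSetting 𝒯 k σ M a f aT fT p gu guh) {T S : Triangle}
    (hS : S ∈ 𝒯.cells) (hST : (cell S ∩ cell T).Nonempty) :
    l2norm (cell S) (fun x => gu x - guh x) ≤ l2norm (𝒯.patch T) (fun x => gu x - guh x) := by
  refine Real.sqrt_le_sqrt (setIntegral_mono_set ?_ (Eventually.of_forall fun x => by positivity)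
    (𝒯.cell_subset_patch hS hST).eventuallyLE)
  -- Square integrability is given on Ω, while the patch may reach the boundary; it is recovered
  -- from finitely many cells, each with null frontier.
  have h : IntegrableOn (fun x => ‖gu x - guh x‖ ^ 2) (⋃ T' ∈ 𝒯.cells, cell T') :=
    integrableOn_finset_iUnion.2 fun T' hT' =>
      (H.memLp_error hT').integrable_norm_pow (by norm_num)
  refine h.mono_set fun x hx => ?_
  simp only [Triangulation.patch, Set.mem_iUnion] at hx ⊢
  obtain ⟨T', hT', -, hx⟩ := hx
  exact ⟨T', hT', hx⟩

theorem Triangulation.hT_mul_l2norm_le_osc (𝒯 : Triangulation Ω) {T S : Triangle}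
    (hS : S ∈ 𝒯.cells) (hST : (cell S ∩ cell T).Nonempty) (f : Plane → ℝ)
    (fT : Triangle → MvPolynomial (Fin 2) ℝ) :
    hT S * l2norm (cell S) (fun x => f x - evalAt (fT S) x) ≤ 𝒯.osc f fT T := by
  classical
  refine Real.le_sqrt_of_sq_le ?_
  rw [mul_pow]
  exact Finset.single_le_sum
    (f := fun S => hT S ^ 2 * l2norm (cell S) (fun x => f x - evalAt (fT S) x) ^ 2)
    (fun _ _ => by positivity)
    (Finset.mem_filter.2 ⟨hS, 𝒯.cell_subset_patch hS hST⟩)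

/-- The local lower bound for the residual error estimator. -/
theorem exists_estimator_le (k : ℕ) {σ : ℝ} (hσ : 0 < σ) {M : ℝ} (hM : 0 ≤ M) :
    ∃ C, 0 < C ∧ ∀ (Ω : Set Plane) (𝒯 : Triangulation Ω) (a f : Plane → ℝ) (aT : Triangle → ℝ)
      (fT p : Triangle → MvPolynomial (Fin 2) ℝ) (gu guh : Plane → Plane),
      IsResidualSetting 𝒯 k σ M a f aT fT p gu guh → ∀ T ∈ 𝒯.cells,
      etaR aT fT p T + 𝒯.etaJ aT p T ≤
        C * (l2norm (𝒯.patch T) (fun x => gu x - guh x) + 𝒯.osc f fT T) := by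
  obtain ⟨C₁, hC₁, hR⟩ := exists_element_residual_le k hσ hM
  obtain ⟨C₂, hC₂, hJ⟩ := exists_jump_le k hσ hM
  -- Three edges with at most one neighbour each, two adjacent triangles per edge, and a local bound
  -- of (1 + C₁)X for each triangle.
  refine ⟨C₁ + 3 * (C₂ * (2 * (1 + C₁))), by positivity, ?_⟩
  intro Ω 𝒯 a f aT fT p gu guh H T hTc
  set X := l2norm (𝒯.patch T) (fun x => gu x - guh x) + 𝒯.osc f fT T with hX
  have hX0 : 0 ≤ X := add_nonneg (l2norm_nonneg _ _) (Real.sqrt_nonneg _)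
  have hE : ∀ S ∈ 𝒯.cells, (cell S ∩ cell T).Nonempty →
      l2norm (cell S) (fun x => gu x - guh x) +
        hT S * l2norm (cell S) (fun x => f x - evalAt (fT S) x) ≤ X := fun S hS hST =>
    add_le_add (H.l2norm_cell_le_patch hS hST) (𝒯.hT_mul_l2norm_le_osc hS hST f fT)
  have hres : ∀ S ∈ 𝒯.cells, (cell S ∩ cell T).Nonempty →
      hT S * l2norm (cell S) (evalAt (residual (aT S) (fT S) (p S))) ≤ C₁ * X := fun S hS hST =>
    (hR Ω 𝒯 a f aT fT p gu guh H S hS).trans (mul_le_mul_of_nonneg_left (hE S hS hST) hC₁.le)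
  have hloc : ∀ S ∈ 𝒯.cells, (cell S ∩ cell T).Nonempty →
      localBound aT f fT p gu guh S ≤ (1 + C₁) * X := fun S hS hST => by
    have h1 := hE S hS hST
    have h2 := hres S hS hST
    rw [localBound]
    linarith
  have hTT : (cell T ∩ cell T).Nonempty := ⟨_, points_mem_cell T 0, points_mem_cell T 0⟩
  have hetaR : etaR aT fT p T ≤ C₁ * X := by
    have h1 := hres T hTc hTT
    rw [etaR]
    convert! h1 using 4
    exact (evalAt_residual _ _ _ _).symm
  have hetaJ : 𝒯.etaJ aT p T ≤ 3 * (C₂ * (2 * (1 + C₁)) * X) := by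
    classical
    have hY : 0 ≤ C₂ * (2 * (1 + C₁)) * X := by positivity
    have hin : ∀ i, IsInteriorEdge Ω T i → ∑ T' ∈ 𝒯.cells with IsNeighbour T i T',
        Real.sqrt (dist (edgeFst T i) (edgeSnd T i)) *
          l2edge (edgeFst T i) (edgeSnd T i) (fun x =>
            inner ℝ (aT T • gradAt (p T) x - aT T' • gradAt (p T') x)
              (unitNormal (edgeFst T i) (edgeSnd T i))) ≤ C₂ * (2 * (1 + C₁)) * X := by
      intro i hi
      refine (Finset.sum_le_card_nsmul _ _ (C₂ * (2 * (1 + C₁)) * X) fun T' hT' => ?_).trans ?_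
      · obtain ⟨hT'c, hnb⟩ := Finset.mem_filter.1 hT'
        have hmeet : (cell T' ∩ cell T).Nonempty :=
          ⟨edgeFst T i, subset_convexHull ℝ _ hnb.2.1, points_mem_cell T _⟩
        have h1 := hJ Ω 𝒯 a f aT fT p gu guh H T hTc T' hT'c i hi hnb
        have h2 := hloc T hTc hTT
        have h3 := hloc T' hT'c hmeet
        refine h1.trans ?_
        rw [mul_assoc]
        exact mul_le_mul_of_nonneg_left (by linarith) hC₂.le
      · have hcard : (𝒯.cells.filter fun T' => IsNeighbour T i T').card ≤ 1 := by
          refine Finset.card_le_one.2 fun T₁ h₁ T₂ h₂ => ?_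
          obtain ⟨h₁c, h₁n⟩ := Finset.mem_filter.1 h₁
          obtain ⟨h₂c, h₂n⟩ := Finset.mem_filter.1 h₂
          exact 𝒯.isNeighbour_unique H.regular hTc h₁c h₂c h₁n h₂n
        calc _ ≤ 1 • (C₂ * (2 * (1 + C₁)) * X) := nsmul_le_nsmul_left hY hcard
          _ = _ := one_nsmul _
    rw [Triangulation.etaJ]
    refine (Finset.sum_le_card_nsmul _ _ (C₂ * (2 * (1 + C₁)) * X) fun i hi => ?_).trans ?_
    · convert! hin i (Finset.mem_filter.1 hi).2 using 2
    · refine (nsmul_le_nsmul_left hY ((Finset.card_filter_le _ _).trans (Finset.card_fin 3).le)).trans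
        (le_of_eq ?_)
      rw [nsmul_eq_mul]; norm_num
  calc _ ≤ C₁ * X + 3 * (C₂ * (2 * (1 + C₁)) * X) := add_le_add hetaR hetaJ
    _ = _ := by ring

/-- The interior of a cell has positive measure, so some point satisfies both almost-everywhere
statements. -/
theorem abs_coefficient_le (hΩ : Triangulation Ω) {T : Triangle} (hT : T ∈ hΩ.cells)
    (hM : ∀ᵐ x ∂volume.restrict Ω, |a x| ≤ M) {α : ℝ}
    (hα : ∀ᵐ x ∂volume.restrict (cell T), a x = α) : |α| ≤ M := by
  rw [← restrict_interior_cell] at hα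
  have h1 := ae_restrict_of_ae_restrict_of_subset (hΩ.interior_subset T hT) hM
  have : NeBot (ae ((volume : Measure Plane).restrict (interior (cell T)))) := by
    rw [ae_neBot, Ne, Measure.restrict_eq_zero]
    exact isOpen_interior.measure_ne_zero _ (interior_cell_nonempty T)
  obtain ⟨x, hx, hx'⟩ := (h1.and hα).exists
  rwa [← hx']

end SignFEM

theorem theorem3 (ℓ : ℕ) (hℓ : 1 ≤ ℓ) (m : ℕ) (σ M : ℝ) :
    ∃ C : ℝ, 0 < C ∧
      ∀ (Ω Ωp Ωm : Set Plane)
        (_ : IsOpen Ω) (_ : Bornology.IsBounded Ω)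
        (_ : IsOpen Ωp) (_ : IsOpen Ωm) (_ : Ωp ⊆ Ω) (_ : Ωm ⊆ Ω)
        (_ : closure Ω = closure Ωp ∪ closure Ωm) (_ : Ωp ∩ Ωm = ∅)
        -- the diffusion coefficient
        (a : Plane → ℝ) (_ : AEStronglyMeasurable a (volume.restrict Ω))
        (_ : ∀ᵐ x ∂volume.restrict Ω, |a x| ≤ M)
        (ε₀ : ℝ) (_ : 0 < ε₀)
        (_ : ∀ᵐ x ∂volume.restrict Ωp, ε₀ ≤ a x)
        (_ : ∀ᵐ x ∂volume.restrict Ωm, a x ≤ -ε₀)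
        -- the triangulation; `a` is constant on each triangle
        (𝒯 : Triangulation Ω) (_ : 𝒯.IsRegular σ)
        (_ : ∀ T ∈ 𝒯.cells, cell T ⊆ closure Ωp ∨ cell T ⊆ closure Ωm)
        (aT : Triangle → ℝ)
        (_ : ∀ T ∈ 𝒯.cells, ∀ᵐ x ∂volume.restrict (cell T), a x = aT T)
        -- the right-hand side and its elementwise approximation
        (f : Plane → ℝ) (_ : MemLp f 2 (volume.restrict Ω))
        (fT : Triangle → MvPolynomial (Fin 2) ℝ)
        (_ : ∀ T ∈ 𝒯.cells, (fT T).totalDegree ≤ m)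
        -- the exact solution
        (u : Plane → ℝ) (gu : Plane → Plane) (_ : IsWeakSolution Ω a f u gu)
        -- the discrete solution and its polynomials on the triangles
        (uh : Plane → ℝ) (guh : Plane → Plane) (_ : 𝒯.IsGalerkin ℓ a f uh guh)
        (p : Triangle → MvPolynomial (Fin 2) ℝ) (_ : 𝒯.IsPiecewisePoly ℓ uh p),
        ∀ T ∈ 𝒯.cells,
          etaR aT fT p T + 𝒯.etaJ aT p T ≤
            C * (l2norm (𝒯.patch T) (fun x => gu x - guh x) + 𝒯.osc f fT T) := by
  -- A regular triangulation with σ ≤ 0 has no cells, since h_T > 0; any constant will do.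
  rcases le_or_gt σ 0 with hσ | hσ
  · refine ⟨1, one_pos, ?_⟩
    intro Ω Ωp Ωm _ _ _ _ _ _ _ _ a _ _ ε₀ _ _ _ 𝒯 hreg _ _ _ _ _ _ _ _ _ _ _ _ _ _ _ T hT
    exact absurd (aspect_pos (hreg T hT)) (not_lt.2 hσ)
  -- The degree max m ℓ covers both f_T and u_h, hence the residual and the jump; max M 0 supplies
  -- the required nonnegativity.
  obtain ⟨C, hC, h⟩ := exists_estimator_le (max m ℓ) hσ (le_max_right M 0)
  refine ⟨C, hC, ?_⟩
  intro Ω Ωp Ωm hΩ _ _ _ _ _ _ _ a _ haM ε₀ _ _ _ 𝒯 hreg _ aT haT f hf fT hfT u gu hu uh guh huh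
    p hp
  refine h Ω 𝒯 a f aT fT p gu guh
    { isOpen := hΩ
      regular := hreg
      abs_le := fun T hT => (abs_coefficient_le 𝒯 hT haM (haT T hT)).trans (le_max_left _ _)
      a_eq := haT
      memLp_f := hf
      memLp_gu := hu.1.memLp_grad
      memLp_guh := huh.1.1.memLp_grad
      weak := fun φ hφ => hu.2 φ (gradient φ) hφ.isH10
      guh_eq := fun T hT => ?_
      degree_f := fun T hT => (hfT T hT).trans (le_max_left _ _)
      degree_p := fun T hT => (hp T hT).1.trans (le_max_right _ _) }
  have h1 := (hp T hT).2
  -- Identifying the weak gradient requires an open set; the frontier of a cell is null.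
  rw [← restrict_interior_cell] at h1 ⊢
  exact huh.1.1.toIsH1.ae_eq_gradAt hΩ isOpen_interior (𝒯.interior_subset T hT) (p T) h1
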